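/- Let $0<\beta<1$ and let $p=p(N)\in(0,1]$ satisfy $p(N)^3N^2\to\infty$ as $N\to\infty$. For each $N$ let $G(N,p)$ be the directed Erdős–Rényi random graph with loops on $\{1,\dots,N\}$: the indicators $\varepsilon_{i,j}$ of the directed edges $(i,j)$, $1\le i,j\le N$ ($i=j$ allowed), are independent with $\mathbb P[\varepsilon_{i,j}=1]=p$ and $\mathbb P[\varepsilon_{i,j}=0]=1-p$. For $\sigma\in\{-1,+1\}^N$ put $$H(\sigma)=-\frac1{2Np}\sum_{i,j=1}^N\varepsilon_{i,j}\sigma_i\sigma_j,\qquad Z_N(\beta)=\sum_{\sigma\in\{-1,+1\}^N}e^{-\beta H(\sigma)},$$ and let $$L_N=\frac1{Z_N(\beta)}\sum_{\sigma\in\{-1,+1\}^N}e^{-\beta H(\sigma)}\,\delta_{\frac1{\sqrt N}\sum_{i=1}^N\sigma_i}$$ be the distribution of $\frac1{\sqrt N}\sum_{i=1}^N\sigma_i$ under the Gibbs measure, a random element of the space $\mathcal M(\mathbb R)$ of probability measures on $\mathbb R$. Let $$d_L(\mu_1,\mu_2)=\inf\{\varepsilon>0:\ \mu_1(-\infty,t-\varepsilon]-\varepsilon\le\mu_2(-\infty,t]\le\mu_1(-\infty,t+\varepsilon]+\varepsilon\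 \text{ for all } t\in\mathbb R\}$$ be the Lévy metric on $\mathcal M(\mathbb R)$, and let $\mathfrak N_{0,1/(1-\beta)}$ be the normal distribution with mean $0$ and variance $1/(1-\beta)$. Then $L_N$ converges in probability to $\mathfrak N_{0,1/(1-\beta)}$, that is, for every $\varepsilon>0$, $$\lim_{N\to\infty}\mathbb P\big[d_L(L_N,\mathfrak N_{0,1/(1-\beta)})>\varepsilon\big]=0.$$ -/

import Mathlib

open MeasureTheory ProbabilityTheory Filter
open scoped Topology

namespace DiluteIsing

/-- `G` is a directed Erdős–Rényi random graph with loops on the vertices `Fin N`, defined on the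
probability space `(Ω, P)`: the events "the edge `(i, j)` is present", over all ordered pairs
`(i, j)` (with `i = j` allowed), are independent and each has probability `p`. -/
structure IsDirectedErdosRenyi {Ω : Type*} [MeasurableSpace Ω] (P : Measure Ω) (N : ℕ) (p : ℝ)
    (G : Ω → Digraph (Fin N)) : Prop where
  measurableSet_edge : ∀ i j : Fin N, MeasurableSet {ω | (G ω).Adj i j}
  prob_edge : ∀ i j : Fin N, P {ω | (G ω).Adj i j} = ENNReal.ofReal p
  indep_edge : iIndepSet (fun e : Fin N × Fin N => {ω | (G ω).Adj e.1 e.2}) P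

/-- The value in `ℝ` of the spin at the vertex `i`. Spin configurations on `N` vertices are the
functions `Fin N → ℤˣ`, where `ℤˣ = {1, -1}`. -/
def spin {N : ℕ} (σ : Fin N → ℤˣ) (i : Fin N) : ℝ := ((σ i : ℤ) : ℝ)

open Classical in
/-- The indicator variable of the edge `(i, j)`. -/
noncomputable def edgeIndicator {N : ℕ} (G : Digraph (Fin N)) (i j : Fin N) : ℝ :=
  if G.Adj i j then 1 else 0

/-- `H(σ) = -(1 / (2 N p)) ∑_{i,j} ε_{i,j} σ_i σ_j`. -/
noncomputable def hamiltonian {N : ℕ} (p : ℝ) (G : Digraph (Fin N)) (σ : Fin N → ℤˣ) : ℝ :=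
  -(1 / (2 * (N : ℝ) * p)) * ∑ i, ∑ j, edgeIndicator G i j * spin σ i * spin σ j

/-- `Z_N(β) = ∑_σ exp(-β H(σ))`. -/
noncomputable def partitionFunction {N : ℕ} (β p : ℝ) (G : Digraph (Fin N)) : ℝ :=
  ∑ σ : Fin N → ℤˣ, Real.exp (-β * hamiltonian p G σ)

/-- The Gibbs weight `μ_β(σ) = exp(-β H(σ)) / Z_N(β)`. -/
noncomputable def gibbsWeight {N : ℕ} (β p : ℝ) (G : Digraph (Fin N)) (σ : Fin N → ℤˣ) : ℝ :=
  Real.exp (-β * hamiltonian p G σ) / partitionFunction β p G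

/-- `∑_σ μ_β(σ) δ_{(σ_1 + ... + σ_N) / √N}` as a measure on `ℝ`. -/
noncomputable def magnetizationMeasure {N : ℕ} (β p : ℝ) (G : Digraph (Fin N)) : Measure ℝ :=
  ∑ σ : Fin N → ℤˣ,
    ENNReal.ofReal (gibbsWeight β p G σ) • Measure.dirac ((∑ i, spin σ i) / √(N : ℝ))

theorem partitionFunction_pos {N : ℕ} (β p : ℝ) (G : Digraph (Fin N)) :
    0 < partitionFunction β p G :=
  Finset.sum_pos (fun _ _ => Real.exp_pos _) Finset.univ_nonempty

instance instIsProbabilityMeasureMagnetizationMeasure {N : ℕ} (β p : ℝ) (G : Digraph (Fin N)) :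
    IsProbabilityMeasure (magnetizationMeasure β p G) := by
  constructor
  have hZ := partitionFunction_pos β p G
  simp only [magnetizationMeasure, Measure.coe_finsetSum, Finset.sum_apply, Measure.smul_apply,
    measure_univ, smul_eq_mul, mul_one]
  simp only [gibbsWeight]
  rw [← ENNReal.ofReal_sum_of_nonneg
    (fun σ _ => div_nonneg (Real.exp_pos _).le hZ.le)]
  rw [← Finset.sum_div, ← partitionFunction, div_self hZ.ne', ENNReal.ofReal_one]

/-- `L_N`: the law of `(σ_1 + ... + σ_N) / √N` under the Gibbs measure on the graph `G`, as an
element of the space of probability measures on `ℝ`. -/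
noncomputable def magnetizationLaw {N : ℕ} (β p : ℝ) (G : Digraph (Fin N)) :
    ProbabilityMeasure ℝ :=
  ⟨magnetizationMeasure β p G, inferInstance⟩

/-- The normal distribution on `ℝ` with mean `0` and variance `v` (used for `v ≥ 0`). -/
noncomputable def normalLaw (v : ℝ) : ProbabilityMeasure ℝ :=
  ⟨gaussianReal 0 v.toNNReal, inferInstance⟩

/-- The Lévy distance of two probability measures on `ℝ`. -/
noncomputable def levyDist (μ₁ μ₂ : ProbabilityMeasure ℝ) : ℝ :=
  sInf {ε : ℝ | 0 < ε ∧ ∀ t : ℝ,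
    (μ₁ : Measure ℝ).real (Set.Iic (t - ε)) - ε ≤ (μ₂ : Measure ℝ).real (Set.Iic t) ∧
    (μ₂ : Measure ℝ).real (Set.Iic t) ≤ (μ₁ : Measure ℝ).real (Set.Iic (t + ε)) + ε}

end DiluteIsing

namespace DiluteIsing

/-! The proof is a second moment argument that compares the quenched model with the Curie–Weiss
model. Put x = β/(2Np), and split the cumulant generating function of a Bernoulli(p) variable into
even and odd parts. Since σ_iσ_j = ±1, averaging exp(-βH(σ)) over the graph gives exp(N² `cgfEven p
x`) exp(`cgfOdd p x` (∑σ_i)²), and `cgfOdd p x` ≈ px = β/(2N). Thus `gibbsSum`, the Gibbs sum of an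
observable g divided by the deterministic factor, has a Curie–Weiss sum as its mean
(`integral_gibbsSum`). For β < 1 these sums converge by the Hubbard–Stratonovich transformation
(`tendsto_curieWeiss`).

The square of `gibbsSum` involves two replicas σ, τ, which the average couples only through the
overlap ∑σ_iτ_i (`integral_gibbsSum_sq`). The coupling is of order 1/(N²p) at most, too weak to
matter (`tendsto_overlapExcess`). What remains is a prefactor whose exponent loses its quadratic
terms by cancellation and is O(1/(p³N²)); this is where p³N² → ∞ is decisive
(`tendsto_sq_mul_cgfEven_sub`). The second moment therefore tends to the square of the limiting
mean, and Chebyshev's inequality gives convergence in probability (`tendsto_measure_gibbsSum`).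

A value of the distribution function of L_N, minus its Gaussian counterpart, is a quotient of two
such sums (`tendsto_measure_cdf`), and finitely many such values control the Lévy distance
(`exists_finset_levyDist_le`). -/

/-- The total magnetization of a spin configuration. -/
noncomputable def spinSum {N : ℕ} (σ : Fin N → ℤˣ) : ℝ := ∑ i, spin σ i

/-- The expectation of `F` under uniformly distributed spins. -/
noncomputable def spinMean {N : ℕ} (F : (Fin N → ℤˣ) → ℝ) : ℝ := (∑ σ, F σ) / 2 ^ N

/-! ### Exponential moments of the Curie–Weiss magnetization. -/

theorem sum_cexp_mul_spinSum {N : ℕ} (w : ℂ) :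
    (∑ σ : Fin N → ℤˣ, Complex.exp (w * spinSum σ)) / 2 ^ N = Complex.cosh w ^ N := by
  have h : ∀ σ : Fin N → ℤˣ, Complex.exp (w * spinSum σ)
      = ∏ i, Complex.exp (w * (((σ i : ℤˣ) : ℤ) : ℂ)) := by
    intro σ
    rw [← Complex.exp_sum, spinSum]
    simp [spin, Finset.mul_sum]
  simp_rw [h]
  rw [← Fintype.piFinset_univ,
    ← Finset.prod_univ_sum (fun _ : Fin N => (Finset.univ : Finset ℤˣ))
      (fun _ u => Complex.exp (w * ((u : ℤ) : ℂ)))]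
  simp [UnitsInt.univ, Complex.cosh, div_pow]

theorem integral_cexp_mul_gaussianReal (z : ℂ) :
    ∫ x : ℝ, Complex.exp (z * x) ∂(gaussianReal 0 1) = Complex.exp (z ^ 2 / 2) := by
  have := complexMGF_id_gaussianReal (μ := 0) (v := 1) z
  simpa [complexMGF] using this

/-- The Hubbard–Stratonovich transformation. -/
theorem sum_cexp_sq_spinSum {N : ℕ} {a : ℝ} (ha : 0 ≤ a) (w : ℂ) :
    (∑ σ : Fin N → ℤˣ, Complex.exp (a * spinSum σ ^ 2 + w * spinSum σ)) / 2 ^ N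
      = ∫ z : ℝ, Complex.cosh (√(2 * a) * z + w) ^ N ∂(gaussianReal 0 1) := by
  have hs : ((√(2 * a) : ℝ) : ℂ) ^ 2 = 2 * a := by
    rw [← Complex.ofReal_pow, Real.sq_sqrt (by positivity)]; push_cast; ring
  have h1 : ∀ (σ : Fin N → ℤˣ) (z : ℝ), Complex.exp ((√(2 * a) * z + w) * spinSum σ)
      = Complex.exp (((√(2 * a) * spinSum σ : ℝ) : ℂ) * z) * Complex.exp (w * spinSum σ) := by
    intro σ z
    rw [← Complex.exp_add]; congr 1; push_cast; ring
  simp_rw [← sum_cexp_mul_spinSum, h1, div_eq_mul_inv]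
  rw [integral_mul_const, integral_finsetSum]
  · congr 1
    refine Finset.sum_congr rfl fun σ _ => ?_
    rw [integral_mul_const, integral_cexp_mul_gaussianReal, ← Complex.exp_add]
    congr 1
    push_cast
    rw [mul_pow, hs]; ring
  · intro σ _
    refine Integrable.mul_const ?_ _
    have := (integrable_exp_mul_gaussianReal (μ := 0) (v := 1) (√(2 * a) * spinSum σ)).ofReal (𝕜 := ℂ)
    refine this.congr (ae_of_all _ fun x => ?_)
    simp

theorem norm_cosh_le (x t : ℝ) :
    ‖Complex.cosh (x + t * Complex.I)‖ ≤ Real.exp (x ^ 2 / 2) := by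
  refine le_trans ?_ (Real.cosh_le_exp_half_sq x)
  rw [Complex.cosh, Real.cosh_eq, norm_div]
  have h1 : ‖Complex.exp (x + t * Complex.I)‖ = Real.exp x := by simp [Complex.norm_exp]
  have h2 : ‖Complex.exp (-(x + t * Complex.I))‖ = Real.exp (-x) := by simp [Complex.norm_exp]
  have := norm_add_le (Complex.exp (x + t * Complex.I)) (Complex.exp (-(x + t * Complex.I)))
  rw [h1, h2] at this
  simpa using div_le_div_of_nonneg_right this (by norm_num : (0:ℝ) ≤ 2)

/-- Supplies a dominating function that depends on neither N nor t. It is Gaussian-integrable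
exactly when c < 1, and that is how β < 1 enters. -/
theorem norm_cosh_pow_le {N : ℕ} {a c : ℝ} (ha : 0 ≤ a) (hc : 2 * a * N ≤ c) (z t : ℝ) :
    ‖Complex.cosh (√(2 * a) * z + t * Complex.I) ^ N‖ ≤ Real.exp (c * z ^ 2 / 2) := by
  rw [norm_pow]
  have h := norm_cosh_le (√(2 * a) * z) t
  push_cast at h
  refine (pow_le_pow_left₀ (norm_nonneg _) h N).trans ?_
  rw [← Real.exp_nat_mul, Real.exp_le_exp, mul_pow, Real.sq_sqrt (by positivity)]
  nlinarith [mul_le_mul_of_nonneg_right hc (sq_nonneg z)]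

theorem integrable_exp_sq_gaussianReal {c : ℝ} (hc : c < 1) :
    Integrable (fun z : ℝ => Real.exp (c * z ^ 2 / 2)) (gaussianReal 0 1) := by
  rw [gaussianReal_of_var_ne_zero _ one_ne_zero,
    integrable_withDensity_iff_integrable_smul' (measurable_gaussianPDF _ _)
      (ae_of_all _ fun _ => gaussianPDF_lt_top)]
  have := ((integrable_exp_neg_mul_sq (b := (1 - c) / 2) (by linarith)).const_mul
    (√(2 * Real.pi * (1 : NNReal)))⁻¹)
  refine this.congr (ae_of_all _ fun z => ?_)
  simp only [toReal_gaussianPDF, gaussianPDFReal, smul_eq_mul]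
  rw [mul_assoc _ (Real.exp _), ← Real.exp_add]
  congr 2
  push_cast
  ring

theorem spinMean_exp_sq_le {N : ℕ} {a c : ℝ} (ha : 0 ≤ a) (hc : 2 * a * N ≤ c) (hc1 : c < 1) :
    spinMean (fun σ : Fin N → ℤˣ => Real.exp (a * spinSum σ ^ 2))
      ≤ ∫ z : ℝ, Real.exp (c * z ^ 2 / 2) ∂(gaussianReal 0 1) := by
  have h := sum_cexp_sq_spinSum (N := N) ha 0
  have h0 : 0 ≤ spinMean (fun σ : Fin N → ℤˣ => Real.exp (a * spinSum σ ^ 2)) :=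
    div_nonneg (Finset.sum_nonneg fun _ _ => (Real.exp_pos _).le) (by positivity)
  have h1 : ((spinMean (fun σ : Fin N → ℤˣ => Real.exp (a * spinSum σ ^ 2)) : ℝ) : ℂ)
      = ∫ z : ℝ, Complex.cosh (√(2 * a) * z + 0) ^ N ∂(gaussianReal 0 1) := by
    rw [← h, spinMean]; push_cast; simp
  calc _ = ‖((spinMean (fun σ : Fin N → ℤˣ => Real.exp (a * spinSum σ ^ 2)) : ℝ) : ℂ)‖ := by
        rw [Complex.norm_real, Real.norm_of_nonneg h0]
    _ ≤ _ := by
        rw [h1]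
        refine norm_integral_le_of_norm_le (integrable_exp_sq_gaussianReal hc1)
          (ae_of_all _ fun z => ?_)
        simpa using norm_cosh_pow_le ha hc z 0

/-- Rests on cosh y - 1 = 2 sinh²(y/2), which gives N(cosh(w/√N) - 1) → v²/2. The argument w varies
with N because the coupling equals β/(2N) only asymptotically. -/
theorem tendsto_cosh_pow {w : ℕ → ℂ} {v : ℂ} (hw : Tendsto w atTop (𝓝 v)) :
    Tendsto (fun N : ℕ => Complex.cosh (w N / √(N : ℝ)) ^ N) atTop (𝓝 (Complex.exp (v ^ 2 / 2))) := by
  have hsq : Tendsto (fun N : ℕ => ((√(N : ℝ) : ℝ) : ℂ)⁻¹) atTop (𝓝 0) := by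
    have : Tendsto (fun N : ℕ => (√(N : ℝ))⁻¹) atTop (𝓝 0) :=
      tendsto_inv_atTop_zero.comp (Real.tendsto_sqrt_atTop.comp tendsto_natCast_atTop_atTop)
    have := (Complex.continuous_ofReal.tendsto 0).comp this
    simpa [Function.comp_def] using this
  have hx : Tendsto (fun N : ℕ => w N / 2 * ((√(N : ℝ) : ℝ) : ℂ)⁻¹) atTop (𝓝 0) := by
    simpa using (hw.div_const 2).mul hsq
  -- `dslope` is sinh x / x extended continuously to 0, so no case distinction is needed when `w N`
  -- vanishes.
  have hd : Tendsto (dslope Complex.sinh 0) (𝓝 0) (𝓝 1) := by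
    have h1 : ContinuousAt (dslope Complex.sinh 0) 0 :=
      continuousAt_dslope_same.2 Complex.differentiable_sinh.differentiableAt
    have h2 : dslope Complex.sinh 0 0 = 1 := by simp [dslope_same]
    rw [← h2]; exact h1
  have hlim := (((hw.div_const 2).mul (hd.comp hx)).pow 2).const_mul 2
  have key : Tendsto (fun N : ℕ => (N : ℂ) * (Complex.cosh (w N / √(N : ℝ)) - 1)) atTop
      (𝓝 (v ^ 2 / 2)) := by
    refine (hlim.congr' ?_).trans (by rw [show 2 * (v / 2 * 1) ^ 2 = v ^ 2 / 2 by ring])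
    filter_upwards [eventually_gt_atTop 0] with N hN
    have hN0 : ((√(N : ℝ) : ℝ) : ℂ) ≠ 0 := by
      have : 0 < √(N : ℝ) := Real.sqrt_pos.2 (by exact_mod_cast hN)
      exact_mod_cast this.ne'
    have hN2 : (N : ℂ) = ((√(N : ℝ) : ℝ) : ℂ) ^ 2 := by
      rw [← Complex.ofReal_pow, Real.sq_sqrt (by positivity)]; simp
    set x := w N / 2 * ((√(N : ℝ) : ℝ) : ℂ)⁻¹ with hxdef
    have hs : Complex.sinh x = x * dslope Complex.sinh 0 x := by
      have := sub_smul_dslope Complex.sinh 0 x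
      simpa using this.symm
    have hc : Complex.cosh (w N / √(N : ℝ)) - 1 = 2 * Complex.sinh x ^ 2 := by
      have : w N / √(N : ℝ) = 2 * x := by rw [hxdef]; field_simp
      rw [this, Complex.cosh_two_mul, Complex.cosh_sq]; ring
    rw [hc, hs, hN2, hxdef]
    simp only [Function.comp]
    field_simp
  have := Complex.tendsto_one_add_pow_exp_of_tendsto key
  simpa using this

theorem integral_cexp_half_sq_gaussianReal {β : ℝ} (hβ₀ : 0 ≤ β) (hβ₁ : β < 1) (t : ℝ) :
    ∫ z : ℝ, Complex.exp ((√β * z + t * Complex.I) ^ 2 / 2) ∂(gaussianReal 0 1)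
      = (((√(1 - β))⁻¹ : ℝ) : ℂ) * Complex.exp (-((1 / (1 - β) : ℝ) : ℂ) * t ^ 2 / 2) := by
  have hs : ((√β : ℝ) : ℂ) ^ 2 = β := by
    rw [← Complex.ofReal_pow, Real.sq_sqrt hβ₀]
  have h1 : (0 : ℝ) < 1 - β := by linarith
  have h1' : ((1 : ℂ) - β) ≠ 0 := by exact_mod_cast h1.ne'
  rw [integral_gaussianReal_eq_integral_smul one_ne_zero]
  have hre : ((((β - 1) / 2 : ℝ) : ℂ)).re < 0 := by simp only [Complex.ofReal_re]; linarith
  have key := integral_cexp_quadratic hre (√β * t * Complex.I) (-(t : ℂ) ^ 2 / 2)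
  have h2 : ∀ z : ℝ, gaussianPDFReal 0 1 z • Complex.exp ((√β * z + t * Complex.I) ^ 2 / 2)
      = (((√(2 * Real.pi))⁻¹ : ℝ) : ℂ) * Complex.exp ((((β - 1) / 2 : ℝ) : ℂ) * z ^ 2
        + √β * t * Complex.I * z + -(t : ℂ) ^ 2 / 2) := by
    intro z
    simp only [gaussianPDFReal, Complex.real_smul]
    push_cast
    rw [mul_assoc, ← Complex.exp_add]
    congr 2
    · simp
    · simp only [sub_zero]
      linear_combination ((z:ℂ) ^ 2 / 2) * hs + ((t : ℂ) ^ 2 / 2) * Complex.I_sq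
  simp_rw [h2]
  rw [integral_const_mul, key, ← mul_assoc]
  congr 1
  · have : (Real.pi : ℂ) / -(((β - 1) / 2 : ℝ) : ℂ) = ((2 * Real.pi / (1 - β) : ℝ) : ℂ) := by
      push_cast
      have h3 : ((β : ℂ) - 1) ≠ 0 := by rw [← neg_sub]; exact neg_ne_zero.2 h1'
      field_simp
      ring
    rw [this, show (1 / 2 : ℂ) = ((1 / 2 : ℝ) : ℂ) by push_cast; rfl,
      ← Complex.ofReal_cpow (by positivity), ← Complex.ofReal_mul, ← Real.sqrt_eq_rpow,
      Real.sqrt_div (by positivity)]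
    congr 1
    have : √(2 * Real.pi) ≠ 0 := by positivity
    field_simp
  · congr 1
    push_cast
    have h3 : ((β : ℂ) - 1) ≠ 0 := by rw [← neg_sub]; exact neg_ne_zero.2 h1'
    have : (√β * t * Complex.I : ℂ) ^ 2 = - (β * t ^ 2) := by
      rw [mul_pow, mul_pow, hs, Complex.I_sq]; ring
    rw [this]
    field_simp
    ring

/-- Dominated convergence in the Hubbard–Stratonovich integral. The coefficient `a` is left general
because the first and second moments over the graph produce different ones. -/
theorem tendsto_sum_cexp_sq_spinSum {β : ℝ} (hβ₀ : 0 < β) (hβ₁ : β < 1) {a : ℕ → ℝ}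
    (ha : Tendsto (fun N : ℕ => a N * N) atTop (𝓝 (β / 2))) (t : ℝ) :
    Tendsto (fun N : ℕ => (∑ σ : Fin N → ℤˣ, Complex.exp (a N * spinSum σ ^ 2
        + (t / √(N : ℝ) : ℝ) * Complex.I * spinSum σ)) / 2 ^ N) atTop
      (𝓝 ((((√(1 - β))⁻¹ : ℝ) : ℂ) * Complex.exp (-((1 / (1 - β) : ℝ) : ℂ) * t ^ 2 / 2))) := by
  have h2a : Tendsto (fun N : ℕ => 2 * (a N * N)) atTop (𝓝 β) := by
    simpa [mul_div_cancel₀] using ha.const_mul 2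
  -- (1 + β)/2 lies strictly between the limit β and the integrability threshold 1.
  have hpos : ∀ᶠ N : ℕ in atTop, 0 ≤ a N ∧ 2 * a N * N ≤ (1 + β) / 2 ∧ 0 < N := by
    filter_upwards [ha.eventually_const_lt (show (0:ℝ) < β / 2 by linarith),
      h2a.eventually_le_const (show β < (1 + β) / 2 by linarith), eventually_gt_atTop 0] with N h h' hN
    have hN' : (0:ℝ) < N := by exact_mod_cast hN
    exact ⟨(pos_of_mul_pos_left h hN'.le).le, by linarith, hN⟩
  rw [← integral_cexp_half_sq_gaussianReal hβ₀.le hβ₁]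
  have hD : Tendsto (fun N : ℕ => ∫ z : ℝ, Complex.cosh (√(2 * a N) * z
      + (t / √(N : ℝ) : ℝ) * Complex.I) ^ N ∂(gaussianReal 0 1)) atTop
      (𝓝 (∫ z : ℝ, Complex.exp ((√β * z + t * Complex.I) ^ 2 / 2) ∂(gaussianReal 0 1))) := by
    refine tendsto_integral_filter_of_dominated_convergence
      (fun z => Real.exp ((1 + β) / 2 * z ^ 2 / 2)) ?_ ?_
      (integrable_exp_sq_gaussianReal (by linarith)) ?_
    · refine Eventually.of_forall fun N => Continuous.aestronglyMeasurable ?_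
      fun_prop
    · filter_upwards [hpos] with N hN
      exact ae_of_all _ fun z => norm_cosh_pow_le hN.1 hN.2.1 z _
    · refine ae_of_all _ fun z => ?_
      have hw : Tendsto (fun N : ℕ => ((√(2 * (a N * N)) : ℝ) : ℂ) * z + t * Complex.I) atTop
          (𝓝 (√β * z + t * Complex.I)) := by
        have := (Complex.continuous_ofReal.tendsto _).comp ((Real.continuous_sqrt.tendsto _).comp h2a)
        exact (this.mul_const _).add_const _
      refine (tendsto_cosh_pow hw).congr' ?_
      filter_upwards [hpos] with N hN
      have hN' : √(N : ℝ) ≠ 0 := (Real.sqrt_pos.2 (by exact_mod_cast hN.2.2)).ne'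
      have hN0 : ((√(N : ℝ) : ℝ) : ℂ) ≠ 0 := by exact_mod_cast hN'
      congr 2
      rw [← mul_assoc, Real.sqrt_mul (by linarith [hN.1])]
      push_cast
      field_simp
  refine hD.congr' ?_
  filter_upwards [hpos] with N hN
  rw [← sum_cexp_sq_spinSum hN.1]

/-! ### Laws of the normalized magnetization under weights. -/

/-- The normalized magnetization `(σ_1 + ... + σ_N) / √N`. -/
noncomputable def scaledMag {N : ℕ} (σ : Fin N → ℤˣ) : ℝ := spinSum σ / √(N : ℝ)

/-- The law of the normalized magnetization under the probability measure on spin configurations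
proportional to the weight `W`. -/
noncomputable def weightedMeasure {N : ℕ} (W : (Fin N → ℤˣ) → ℝ) : Measure ℝ :=
  ∑ σ, ENNReal.ofReal (W σ / ∑ τ, W τ) • Measure.dirac (scaledMag σ)

theorem magnetizationMeasure_eq {N : ℕ} (β p : ℝ) (G : Digraph (Fin N)) :
    magnetizationMeasure β p G
      = weightedMeasure (fun σ => Real.exp (-β * hamiltonian p G σ)) := rfl

theorem isProbabilityMeasure_weightedMeasure {N : ℕ} {W : (Fin N → ℤˣ) → ℝ} (hW : ∀ σ, 0 < W σ) :
    IsProbabilityMeasure (weightedMeasure W) := by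
  constructor
  have hZ : 0 < ∑ τ, W τ := Finset.sum_pos (fun σ _ => hW σ) Finset.univ_nonempty
  simp only [weightedMeasure, Measure.coe_finsetSum, Finset.sum_apply, Measure.smul_apply,
    measure_univ, smul_eq_mul, mul_one]
  rw [← ENNReal.ofReal_sum_of_nonneg (fun σ _ => div_nonneg (hW σ).le hZ.le),
    ← Finset.sum_div, div_self hZ.ne', ENNReal.ofReal_one]

/-- `weightedMeasure` as an element of the space of probability measures on `ℝ`. -/
noncomputable def weightedLaw {N : ℕ} (W : (Fin N → ℤˣ) → ℝ) (hW : ∀ σ, 0 < W σ) :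
    ProbabilityMeasure ℝ :=
  ⟨weightedMeasure W, isProbabilityMeasure_weightedMeasure hW⟩

theorem weightedMeasure_real_Iic {N : ℕ} {W : (Fin N → ℤˣ) → ℝ} (hW : ∀ σ, 0 < W σ) (t : ℝ) :
    (weightedMeasure W).real (Set.Iic t)
      = (∑ σ, W σ * (Set.Iic t).indicator 1 (scaledMag σ)) / ∑ σ, W σ := by
  have hZ : 0 < ∑ τ, W τ := Finset.sum_pos (fun σ _ => hW σ) Finset.univ_nonempty
  rw [Measure.real, weightedMeasure, Measure.coe_finsetSum, Finset.sum_apply,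
    ENNReal.toReal_sum (fun σ _ => by
      simpa [Measure.smul_apply] using ENNReal.mul_ne_top ENNReal.ofReal_ne_top (measure_ne_top (Measure.dirac (scaledMag σ)) _)),
    Finset.sum_div]
  refine Finset.sum_congr rfl fun σ _ => ?_
  rw [Measure.smul_apply, smul_eq_mul, ENNReal.toReal_mul,
    ENNReal.toReal_ofReal (div_nonneg (hW σ).le hZ.le), Measure.dirac_apply' _ measurableSet_Iic]
  by_cases h : scaledMag σ ∈ Set.Iic t
  · simp [Set.indicator_of_mem h]
  · simp [Set.indicator_of_notMem h]

theorem charFun_weightedMeasure {N : ℕ} {W : (Fin N → ℤˣ) → ℝ} (hW : ∀ σ, 0 < W σ) (t : ℝ) :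
    charFun (weightedMeasure W) t
      = (∑ σ, W σ * Complex.exp (t * scaledMag σ * Complex.I)) / ∑ σ, (W σ : ℂ) := by
  have hZ : 0 < ∑ τ, W τ := Finset.sum_pos (fun σ _ => hW σ) Finset.univ_nonempty
  rw [charFun_apply_real, weightedMeasure, integral_finsetSum_measure, Finset.sum_div]
  · refine Finset.sum_congr rfl fun σ _ => ?_
    rw [integral_smul_measure, integral_dirac,
      ENNReal.toReal_ofReal (div_nonneg (hW σ).le hZ.le), Complex.real_smul]
    push_cast
    ring
  · intro σ _
    exact (integrable_dirac (by simp [enorm_lt_top])).smul_measure ENNReal.ofReal_ne_top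

theorem spinMean_eq_sum_cexp {N : ℕ} (a : ℝ) :
    ((spinMean (fun σ : Fin N → ℤˣ => Real.exp (a * spinSum σ ^ 2)) : ℝ) : ℂ)
      = (∑ σ : Fin N → ℤˣ, Complex.exp (a * spinSum σ ^ 2
        + ((0 : ℝ) / √(N : ℝ) : ℝ) * Complex.I * spinSum σ)) / 2 ^ N := by
  rw [spinMean]; push_cast; simp

/-! ### Central limit theorem for the Curie–Weiss model. -/

section CurieWeiss

variable {β : ℝ} {a : ℕ → ℝ}

theorem tendsto_spinMean_exp_sq (hβ₀ : 0 < β) (hβ₁ : β < 1)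
    (ha : Tendsto (fun N : ℕ => a N * N) atTop (𝓝 (β / 2))) :
    Tendsto (fun N : ℕ => spinMean (fun σ : Fin N → ℤˣ => Real.exp (a N * spinSum σ ^ 2))) atTop
      (𝓝 (√(1 - β))⁻¹) := by
  have h := tendsto_sum_cexp_sq_spinSum hβ₀ hβ₁ ha 0
  simp_rw [← spinMean_eq_sum_cexp] at h
  have h' := (Complex.continuous_re.tendsto _).comp h
  refine h'.trans (le_of_eq ?_)
  congr 1
  simp [-Complex.ofReal_inv]

/-- The central limit theorem for the Curie–Weiss model at high temperature. -/
theorem tendsto_curieWeiss (hβ₀ : 0 < β) (hβ₁ : β < 1)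
    (ha : Tendsto (fun N : ℕ => a N * N) atTop (𝓝 (β / 2))) :
    Tendsto (fun N : ℕ => weightedLaw (fun σ : Fin N → ℤˣ => Real.exp (a N * spinSum σ ^ 2))
      fun _ => Real.exp_pos _) atTop
      (𝓝 (normalLaw (1 / (1 - β)))) := by
  have h1 : 0 < 1 - β := by linarith
  refine ProbabilityMeasure.tendsto_of_tendsto_charFun fun t => ?_
  have hnum := tendsto_sum_cexp_sq_spinSum hβ₀ hβ₁ ha t
  have hden := tendsto_sum_cexp_sq_spinSum hβ₀ hβ₁ ha 0
  have hne : (((√(1 - β))⁻¹ : ℝ) : ℂ) ≠ 0 := by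
    have : (√(1 - β))⁻¹ ≠ 0 := by positivity
    exact_mod_cast this
  have hq := hnum.div hden (mul_ne_zero hne (Complex.exp_ne_zero _))
  rw [mul_div_mul_left _ _ hne] at hq
  convert! hq using 1
  · ext N
    have h2 : (2 : ℂ) ^ N ≠ 0 := pow_ne_zero _ two_ne_zero
    simp only [weightedLaw, ProbabilityMeasure.coe_mk, Pi.div_apply]
    rw [charFun_weightedMeasure (fun _ => Real.exp_pos _), div_div_div_cancel_right₀ h2]
    congr 1
    · refine Finset.sum_congr rfl fun σ _ => ?_
      rw [Complex.ofReal_exp, ← Complex.exp_add, scaledMag]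
      congr 1
      push_cast
      ring
    · refine Finset.sum_congr rfl fun σ _ => ?_
      simp
  · congr 1
    simp only [normalLaw, ProbabilityMeasure.coe_mk, charFun_gaussianReal]
    have : (((1 / (1 - β)).toNNReal : ℝ) : ℂ) = ((1 / (1 - β) : ℝ) : ℂ) := by
      rw [Real.coe_toNNReal _ (by positivity)]
    simp only [this, Complex.ofReal_zero]
    simp [neg_div]

/-- The portmanteau theorem applies because the Gaussian limit has no atoms; multiplying by the
limit of the normalization undoes the quotient. -/
theorem tendsto_spinMean_exp_sq_mul_indicator (hβ₀ : 0 < β) (hβ₁ : β < 1)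
    (ha : Tendsto (fun N : ℕ => a N * N) atTop (𝓝 (β / 2))) (t : ℝ) :
    Tendsto (fun N : ℕ => spinMean (fun σ : Fin N → ℤˣ => Real.exp (a N * spinSum σ ^ 2)
      * (Set.Iic t).indicator 1 (scaledMag σ))) atTop
      (𝓝 ((√(1 - β))⁻¹ * (normalLaw (1 / (1 - β)) : Measure ℝ).real (Set.Iic t))) := by
  have h1 : 0 < 1 - β := by linarith
  have hv : (1 / (1 - β)).toNNReal ≠ 0 := by
    rw [Ne, Real.toNNReal_eq_zero, not_le]; positivity
  have hfr : normalLaw (1 / (1 - β)) (frontier (Set.Iic t)) = 0 := by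
    rw [frontier_Iic, ProbabilityMeasure.null_iff_toMeasure_null]
    have := nullSingletonClass_gaussianReal (μ := 0) hv
    simp only [normalLaw, ProbabilityMeasure.coe_mk]
    exact measure_singleton t
  have h := ProbabilityMeasure.tendsto_measure_of_null_frontier_of_tendsto
    (tendsto_curieWeiss hβ₀ hβ₁ ha) hfr
  have h' := (NNReal.continuous_coe.tendsto _).comp h
  refine ((tendsto_spinMean_exp_sq hβ₀ hβ₁ ha).mul h').congr fun N => ?_
  have hZ : 0 < ∑ σ : Fin N → ℤˣ, Real.exp (a N * spinSum σ ^ 2) :=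
    Finset.sum_pos (fun σ _ => Real.exp_pos _) Finset.univ_nonempty
  simp only [Function.comp]
  have h3 := weightedMeasure_real_Iic (W := fun σ : Fin N → ℤˣ => Real.exp (a N * spinSum σ ^ 2))
    (fun _ => Real.exp_pos _) t
  have h4 := congrArg (fun x => spinMean (fun σ : Fin N → ℤˣ => Real.exp (a N * spinSum σ ^ 2)) * x) h3
  refine Eq.trans h4 ?_
  simp only [spinMean]
  field_simp

end CurieWeiss

/-! ### Averages over one and two replicas, and the overlap coupling. -/

theorem spinMean_mono {N : ℕ} {F F' : (Fin N → ℤˣ) → ℝ} (h : ∀ σ, F σ ≤ F' σ) :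
    spinMean F ≤ spinMean F' :=
  div_le_div_of_nonneg_right (Finset.sum_le_sum fun σ _ => h σ) (by positivity)

theorem spinMean_add {N : ℕ} (F F' : (Fin N → ℤˣ) → ℝ) :
    spinMean (fun σ => F σ + F' σ) = spinMean F + spinMean F' := by
  simp [spinMean, Finset.sum_add_distrib, add_div]

theorem spinMean_const_mul {N : ℕ} (c : ℝ) (F : (Fin N → ℤˣ) → ℝ) :
    spinMean (fun σ => c * F σ) = c * spinMean F := by
  rw [spinMean, spinMean, ← Finset.mul_sum, mul_div_assoc]

theorem spinMean_mul_const {N : ℕ} (c : ℝ) (F : (Fin N → ℤˣ) → ℝ) :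
    spinMean (fun σ => F σ * c) = spinMean F * c := by
  simp_rw [mul_comm _ c, spinMean_const_mul]

theorem spinMean_const {N : ℕ} (c : ℝ) : spinMean (fun _ : Fin N → ℤˣ => c) = c := by
  simp [spinMean, Fintype.card_units_int]

theorem spinMean_nonneg {N : ℕ} {F : (Fin N → ℤˣ) → ℝ} (h : ∀ σ, 0 ≤ F σ) : 0 ≤ spinMean F :=
  div_nonneg (Finset.sum_nonneg fun σ _ => h σ) (by positivity)

theorem abs_spinMean_le {N : ℕ} (F : (Fin N → ℤˣ) → ℝ) :
    |spinMean F| ≤ spinMean fun σ => |F σ| := by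
  rw [spinMean, abs_div, abs_of_pos (show (0:ℝ) < 2 ^ N by positivity)]
  exact div_le_div_of_nonneg_right (Finset.abs_sum_le_sum_abs _ _) (by positivity)

theorem spinMean_mul_left {N : ℕ} (F : (Fin N → ℤˣ) → ℝ) (σ : Fin N → ℤˣ) :
    spinMean (fun τ => F (σ * τ)) = spinMean F := by
  simp only [spinMean]
  rw [← Equiv.sum_comp (Equiv.mulLeft σ) F]
  rfl

/-- The expectation of `F` under two independent uniformly distributed spin configurations. -/
noncomputable def pairMean {N : ℕ} (F : (Fin N → ℤˣ) → (Fin N → ℤˣ) → ℝ) : ℝ :=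
  spinMean fun σ => spinMean fun τ => F σ τ

theorem pairMean_mul {N : ℕ} (F F' : (Fin N → ℤˣ) → ℝ) :
    pairMean (fun σ τ => F σ * F' τ) = spinMean F * spinMean F' := by
  simp only [pairMean, spinMean_const_mul, spinMean_mul_const]

theorem pairMean_mono {N : ℕ} {F F' : (Fin N → ℤˣ) → (Fin N → ℤˣ) → ℝ}
    (h : ∀ σ τ, F σ τ ≤ F' σ τ) : pairMean F ≤ pairMean F' :=
  spinMean_mono fun σ => spinMean_mono fun τ => h σ τ

theorem pairMean_add {N : ℕ} (F F' : (Fin N → ℤˣ) → (Fin N → ℤˣ) → ℝ) :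
    pairMean (fun σ τ => F σ τ + F' σ τ) = pairMean F + pairMean F' := by
  simp only [pairMean, spinMean_add]

theorem pairMean_const_mul {N : ℕ} (c : ℝ) (F : (Fin N → ℤˣ) → (Fin N → ℤˣ) → ℝ) :
    pairMean (fun σ τ => c * F σ τ) = c * pairMean F := by
  simp only [pairMean, spinMean_const_mul]

theorem abs_pairMean_le {N : ℕ} (F : (Fin N → ℤˣ) → (Fin N → ℤˣ) → ℝ) :
    |pairMean F| ≤ pairMean fun σ τ => |F σ τ| :=
  (abs_spinMean_le _).trans (spinMean_mono fun _ => abs_spinMean_le _)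

/-- The Boltzmann weight of two replicas coupled through their overlap, relative to the
uncoupled one. -/
noncomputable def overlapExcess {N : ℕ} (a b : ℝ) : ℝ :=
  pairMean fun σ τ : Fin N → ℤˣ =>
    Real.exp (a * spinSum σ ^ 2) * Real.exp (a * spinSum τ ^ 2) *
      (Real.exp (b * spinSum (σ * τ) ^ 2) - 1)

/-- x + y is the average of rx and qy with weights 1/r and 1/q, hence at most their maximum. -/
theorem exp_mul_exp_le {r q x y : ℝ} (hrq : r.HolderConjugate q) :
    Real.exp x * Real.exp y ≤ Real.exp (r * x) + Real.exp (q * y) := by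
  have hr := hrq.pos
  have hq := hrq.symm.pos
  have h1 := hrq.inv_add_inv_eq_one
  rw [← Real.exp_add]
  rcases le_total (r * x) (q * y) with h | h
  · have : x + y ≤ q * y := by
      have h2 : x ≤ r⁻¹ * (q * y) := by
        rw [inv_mul_eq_div, le_div_iff₀ hr]; linarith
      have h3 : y = q⁻¹ * (q * y) := by field_simp
      calc x + y ≤ r⁻¹ * (q * y) + q⁻¹ * (q * y) := by linarith
        _ = q * y := by rw [← add_mul, h1, one_mul]
    linarith [Real.exp_le_exp.2 this, Real.exp_pos (r * x)]
  · have : x + y ≤ r * x := by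
      have h2 : y ≤ q⁻¹ * (r * x) := by
        rw [inv_mul_eq_div, le_div_iff₀ hq]; linarith
      have h3 : x = r⁻¹ * (r * x) := by field_simp
      calc x + y ≤ r⁻¹ * (r * x) + q⁻¹ * (r * x) := by linarith
        _ = r * x := by rw [← add_mul, h1, one_mul]
    linarith [Real.exp_le_exp.2 this, Real.exp_pos (q * y)]

theorem exp_mul_sub_one_le {s y : ℝ} (hs : 0 ≤ s) (hs1 : s ≤ 1) :
    Real.exp (s * y) - 1 ≤ s * Real.exp y := by
  have h := convexOn_exp.2 (Set.mem_univ 0) (Set.mem_univ y) (by linarith : 0 ≤ 1 - s) hs (by ring)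
  simp only [smul_eq_mul, mul_zero, zero_add, Real.exp_zero, mul_one] at h
  linarith

/-- Convexity pulls out the small factor `s`. The conjugate exponents then separate the replica
weights from the overlap term, leaving one-replica moments, all subcritical. -/
theorem overlapExcess_le {N : ℕ} {a s κ r q c : ℝ} (hrq : r.HolderConjugate q) (ha : 0 ≤ a)
    (hκ : 0 ≤ κ) (hs : 0 ≤ s) (hs1 : s ≤ 1) (hac : 2 * (r * a) * N ≤ c) (hκc : 2 * (q * κ) * N ≤ c)
    (hc : c < 1) :
    overlapExcess (N := N) a (s * κ)
      ≤ s * ((∫ z : ℝ, Real.exp (c * z ^ 2 / 2) ∂(gaussianReal 0 1)) ^ 2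
        + ∫ z : ℝ, Real.exp (c * z ^ 2 / 2) ∂(gaussianReal 0 1)) := by
  set C := ∫ z : ℝ, Real.exp (c * z ^ 2 / 2) ∂(gaussianReal 0 1)
  have hr := hrq.pos
  have hq := hrq.symm.pos
  calc overlapExcess (N := N) a (s * κ)
      ≤ pairMean fun σ τ : Fin N → ℤˣ => s * (Real.exp (r * a * spinSum σ ^ 2) *
          Real.exp (r * a * spinSum τ ^ 2) + Real.exp (q * κ * spinSum (σ * τ) ^ 2)) := by
        refine pairMean_mono fun σ τ => ?_
        have h1 := exp_mul_sub_one_le (y := κ * spinSum (σ * τ) ^ 2) hs hs1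
        have h2 := exp_mul_exp_le (x := a * spinSum σ ^ 2 + a * spinSum τ ^ 2)
          (y := κ * spinSum (σ * τ) ^ 2) hrq
        rw [← Real.exp_add, ← Real.exp_add]
        rw [← mul_assoc] at h1
        calc _ ≤ Real.exp (a * spinSum σ ^ 2 + a * spinSum τ ^ 2)
              * (s * Real.exp (κ * spinSum (σ * τ) ^ 2)) :=
              mul_le_mul_of_nonneg_left h1 (Real.exp_pos _).le
          _ = s * (Real.exp (a * spinSum σ ^ 2 + a * spinSum τ ^ 2)
              * Real.exp (κ * spinSum (σ * τ) ^ 2)) := by ring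
          _ ≤ _ := by
              refine mul_le_mul_of_nonneg_left (h2.trans (le_of_eq ?_)) hs
              congr 2 <;> ring
    _ = s * (spinMean (fun σ : Fin N → ℤˣ => Real.exp (r * a * spinSum σ ^ 2)) ^ 2
          + spinMean (fun σ : Fin N → ℤˣ => Real.exp (q * κ * spinSum σ ^ 2))) := by
        rw [pairMean_const_mul, pairMean_add, pairMean_mul, sq]
        congr 2
        simp only [pairMean]
        -- For fixed σ, the product σ * τ is again uniformly distributed.
        rw [← spinMean_const (N := N) (spinMean (fun σ : Fin N → ℤˣ =>
          Real.exp (q * κ * spinSum σ ^ 2)))]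
        congr 1
        ext σ
        exact spinMean_mul_left (fun τ => Real.exp (q * κ * spinSum τ ^ 2)) σ
    _ ≤ s * (C ^ 2 + C) := by
        refine mul_le_mul_of_nonneg_left (add_le_add ?_ ?_) hs
        · exact pow_le_pow_left₀ (spinMean_nonneg fun _ => (Real.exp_pos _).le)
            (spinMean_exp_sq_le (by positivity) hac hc) 2
        · exact spinMean_exp_sq_le (by positivity) hκc hc

theorem overlapExcess_nonneg {N : ℕ} {a b : ℝ} (hb : 0 ≤ b) : 0 ≤ overlapExcess (N := N) a b := by
  refine spinMean_nonneg fun σ => spinMean_nonneg fun τ => mul_nonneg (by positivity) ?_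
  linarith [Real.one_le_exp (show 0 ≤ b * spinSum (σ * τ) ^ 2 by positivity)]

theorem tendsto_overlapExcess {β : ℝ} (hβ₀ : 0 < β) (hβ₁ : β < 1) {a b : ℕ → ℝ}
    (ha : Tendsto (fun N : ℕ => a N * N) atTop (𝓝 (β / 2)))
    (hb : Tendsto (fun N : ℕ => b N * N) atTop (𝓝 0)) (hb0 : ∀ᶠ N in atTop, 0 ≤ b N) :
    Tendsto (fun N : ℕ => overlapExcess (N := N) (a N) (b N)) atTop (𝓝 0) := by
  have hβ' : 0 < 1 - β := by linarith
  have hβ'' : 0 < 1 + β := by linarith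
  -- r > 1 is chosen with rβ < 1, so raising the Curie–Weiss weights to the power r keeps them
  -- subcritical.
  set r := 2 / (1 + β) with hr
  set q := 2 / (1 - β) with hq
  have hrq : r.HolderConjugate q := by
    rw [Real.holderConjugate_iff]
    refine ⟨by rw [hr, lt_div_iff₀ hβ'']; linarith, ?_⟩
    rw [hr, hq, inv_div, inv_div]; ring
  have hrβ : r * β < 1 := by rw [hr, div_mul_eq_mul_div, div_lt_one hβ'']; linarith
  set c := max ((1 + r * β) / 2) (1 / 2) with hc
  have hc1 : c < 1 := max_lt (by linarith) (by norm_num)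
  set C := ∫ z : ℝ, Real.exp (c * z ^ 2 / 2) ∂(gaussianReal 0 1)
  have hlim : Tendsto (fun N : ℕ => (4 * q * (b N * N)) * (C ^ 2 + C)) atTop (𝓝 0) := by
    simpa using (hb.const_mul (4 * q)).mul_const (C ^ 2 + C)
  refine tendsto_of_tendsto_of_tendsto_of_le_of_le' tendsto_const_nhds hlim ?_ ?_
  · filter_upwards [hb0] with N hN using overlapExcess_nonneg hN
  have h1 : Tendsto (fun N : ℕ => 2 * r * (a N * N)) atTop (𝓝 (r * β)) := by
    convert ha.const_mul (2 * r) using 2; ring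
  have h2 : Tendsto (fun N : ℕ => 4 * q * (b N * N)) atTop (𝓝 0) := by
    simpa using hb.const_mul (4 * q)
  have hq0 : 0 < q := by positivity
  filter_upwards [hb0, eventually_gt_atTop 0, ha.eventually_const_lt (show (0:ℝ) < β / 2 by linarith),
    h1.eventually_le_const (show r * β < (1 + r * β) / 2 by linarith),
    h2.eventually_le_const one_pos] with N hbN hN haN haN' hbN'
  have hN' : (0:ℝ) < N := by exact_mod_cast hN
  -- Write b = sκ with κ such that 2qκN = 1/2 ≤ c; then s = 4qbN tends to 0.
  have hbe : b N = (4 * q * (b N * N)) * (1 / (4 * q * N)) := by field_simp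
  rw [hbe]
  have := overlapExcess_le (N := N) (a := a N) (s := 4 * q * (b N * N)) (κ := 1 / (4 * q * N)) (c := c)
    hrq (pos_of_mul_pos_left haN hN'.le).le (by positivity) (by positivity) hbN'
    (le_trans (by linarith) (le_max_left _ _)) (le_trans (le_of_eq (by field_simp; norm_num)) (le_max_right _ _)) hc1
  rwa [← hbe] at this ⊢

/-! ### Expansion of the Bernoulli cumulant generating function. -/

/-- The cumulant generating function of a Bernoulli variable with parameter `p`. -/
noncomputable def bernoulliCgf (p x : ℝ) : ℝ := Real.log (1 - p + p * Real.exp x)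

/-- The even part of `bernoulliCgf`. -/
noncomputable def cgfEven (p x : ℝ) : ℝ := (bernoulliCgf p x + bernoulliCgf p (-x)) / 2

/-- The odd part of `bernoulliCgf`. -/
noncomputable def cgfOdd (p x : ℝ) : ℝ := (bernoulliCgf p x - bernoulliCgf p (-x)) / 2

theorem bernoulli_mgf_pos {p : ℝ} (hp₀ : 0 < p) (hp₁ : p ≤ 1) (x : ℝ) :
    0 < 1 - p + p * Real.exp x := by
  have := mul_pos hp₀ (Real.exp_pos x)
  linarith

theorem abs_bernoulliCgf_sub_le {p : ℝ} (hp₀ : 0 < p) (hp₁ : p ≤ 1) {x : ℝ} (hx : |x| ≤ 1 / 4) :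
    |bernoulliCgf p x - p * x| ≤ 9 * p * x ^ 2 := by
  have h1 := Real.abs_exp_sub_one_le (x := x) (by linarith)
  have h2 := Real.abs_exp_sub_one_sub_id_le (x := x) (by linarith)
  set e := Real.exp x - 1 with he
  have h3 : e ^ 2 ≤ 4 * x ^ 2 := by
    have := pow_le_pow_left₀ (abs_nonneg e) h1 2
    rw [sq_abs, mul_pow, sq_abs] at this
    linarith
  have hb : bernoulliCgf p x = Real.log (1 + p * e) := by rw [bernoulliCgf, he]; congr 1; ring
  have hy : -(1 / 2) ≤ p * e := by
    have : |p * e| ≤ 1 / 2 := by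
      rw [abs_mul, abs_of_pos hp₀]
      nlinarith [abs_nonneg e]
    linarith [neg_abs_le (p * e)]
  have hpos : 0 < 1 + p * e := by linarith
  have hup := Real.log_le_sub_one_of_pos hpos
  have hlo := Real.one_sub_inv_le_log_of_pos hpos
  -- For y = pe this amounts to y²(1 + 2y) ≥ 0, hence the need for y ≥ -1/2.
  have hlo' : p * e - 2 * (p * e) ^ 2 ≤ 1 - (1 + p * e)⁻¹ := by
    rw [show 1 - (1 + p * e)⁻¹ = p * e / (1 + p * e) by field_simp; ring, le_div_iff₀ hpos]
    nlinarith [mul_nonneg (sq_nonneg (p * e)) (show 0 ≤ 1 + 2 * (p * e) by linarith)]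
  have hsq : (p * e) ^ 2 ≤ p * (4 * x ^ 2) := by
    rw [mul_pow]
    refine mul_le_mul (by nlinarith) h3 (sq_nonneg _) hp₀.le
  obtain ⟨h4, h5⟩ := abs_le.1 h2
  have h6 := mul_le_mul_of_nonneg_left h4 hp₀.le
  have h7 := mul_le_mul_of_nonneg_left h5 hp₀.le
  have h8 : 0 ≤ p * x ^ 2 := by positivity
  rw [hb, abs_le]
  constructor <;> linarith

theorem cgfEven_eq {p : ℝ} (hp₀ : 0 < p) (hp₁ : p ≤ 1) (x : ℝ) :
    2 * cgfEven p x = Real.log (1 + 2 * p * (1 - p) * (Real.cosh x - 1)) := by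
  rw [cgfEven, mul_div_cancel₀ _ two_ne_zero, bernoulliCgf, bernoulliCgf,
    ← Real.log_mul (bernoulli_mgf_pos hp₀ hp₁ _).ne' (bernoulli_mgf_pos hp₀ hp₁ _).ne', Real.cosh_eq]
  congr 1
  have : Real.exp x * Real.exp (-x) = 1 := by rw [← Real.exp_add]; simp
  linear_combination p ^ 2 * this

theorem cgfEven_nonneg {p : ℝ} (hp₀ : 0 < p) (hp₁ : p ≤ 1) (x : ℝ) : 0 ≤ cgfEven p x := by
  have h := cgfEven_eq hp₀ hp₁ x
  have : 0 ≤ 2 * p * (1 - p) * (Real.cosh x - 1) :=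
    mul_nonneg (mul_nonneg (by positivity) (by linarith)) (by linarith [Real.one_le_cosh x])
  linarith [Real.log_nonneg (show 1 ≤ 1 + 2 * p * (1 - p) * (Real.cosh x - 1) by linarith)]

/-- Evenness removes the cubic term. With x of order 1/(Np), an error p x⁴ summed over N² edges is
of order 1/(p³N²). -/
theorem abs_cgfEven_sub_le {p : ℝ} (hp₀ : 0 < p) (hp₁ : p ≤ 1) {x : ℝ} (hx : |x| ≤ 1) :
    |2 * cgfEven p x - p * (1 - p) * x ^ 2| ≤ 4 * p * x ^ 4 := by
  have hx2 : x ^ 2 ≤ 1 := by rw [← sq_abs]; exact pow_le_one₀ (abs_nonneg x) hx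
  have hup : Real.cosh x - 1 ≤ x ^ 2 / 2 + x ^ 4 / 4 := by
    have h1 := Real.cosh_le_exp_half_sq x
    have h2 := Real.abs_exp_sub_one_sub_id_le (x := x ^ 2 / 2)
      (by rw [abs_of_nonneg (by positivity)]; linarith)
    have h3 := (abs_le.1 h2).2
    nlinarith
  have hlo : x ^ 2 / 2 ≤ Real.cosh x - 1 := by
    have h := Real.cosh_two_mul (x / 2)
    rw [mul_div_cancel₀ _ two_ne_zero, Real.cosh_sq] at h
    have h1 : (x / 2) ^ 2 ≤ Real.sinh (x / 2) ^ 2 := by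
      rw [sq_le_sq, Real.abs_sinh]
      exact Real.self_le_sinh_iff.2 (abs_nonneg _)
    nlinarith
  have hv0 : 0 ≤ p * (1 - p) := mul_nonneg hp₀.le (by linarith)
  have hvp : p * (1 - p) ≤ p := by nlinarith
  rw [cgfEven_eq hp₀ hp₁]
  set y := 2 * p * (1 - p) * (Real.cosh x - 1) with hy
  have hy1 : p * (1 - p) * x ^ 2 ≤ y := by
    have := mul_le_mul_of_nonneg_left hlo hv0
    rw [hy]; linarith
  have hy2 : y ≤ p * (1 - p) * x ^ 2 + p * x ^ 4 / 2 := by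
    have := mul_le_mul_of_nonneg_left hup hv0
    have h3 := mul_le_mul_of_nonneg_right hvp (show 0 ≤ x ^ 4 by positivity)
    rw [hy]; linarith
  have hy0 : 0 ≤ y := le_trans (by positivity) hy1
  have hy3 : y ≤ 3 / 2 * p * x ^ 2 := by
    have h3 := mul_le_mul_of_nonneg_right hvp (sq_nonneg x)
    have h4 : p * x ^ 4 ≤ p * x ^ 2 := by
      refine mul_le_mul_of_nonneg_left ?_ hp₀.le
      nlinarith [sq_nonneg x]
    linarith
  have hpos : 0 < 1 + y := by linarith
  have hlogu := Real.log_le_sub_one_of_pos hpos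
  have hlogl := Real.one_sub_inv_le_log_of_pos hpos
  have hl' : y - y ^ 2 ≤ 1 - (1 + y)⁻¹ := by
    rw [show 1 - (1 + y)⁻¹ = y / (1 + y) by field_simp; ring, le_div_iff₀ hpos]
    nlinarith [pow_nonneg hy0 3]
  have hsq : y ^ 2 ≤ 9 / 4 * p * x ^ 4 := by
    have h5 := pow_le_pow_left₀ hy0 hy3 2
    have h6 : p ^ 2 * x ^ 4 ≤ p * x ^ 4 :=
      mul_le_mul_of_nonneg_right (by nlinarith) (by positivity)
    nlinarith
  have h8 : 0 ≤ p * x ^ 4 := by positivity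
  rw [abs_le]
  constructor <;> linarith

theorem abs_cgfOdd_sub_le {p : ℝ} (hp₀ : 0 < p) (hp₁ : p ≤ 1) {x : ℝ} (hx : |x| ≤ 1 / 4) :
    |cgfOdd p x - p * x| ≤ 9 * p * x ^ 2 := by
  have h1 := abs_le.1 (abs_bernoulliCgf_sub_le hp₀ hp₁ hx)
  have h2 := abs_le.1 (abs_bernoulliCgf_sub_le hp₀ hp₁ (x := -x) (by rwa [abs_neg]))
  rw [neg_sq] at h2
  rw [cgfOdd, abs_le]
  constructor <;> linarith [h1.1, h1.2, h2.1, h2.2]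

/-! ### Asymptotics of the effective couplings. -/

section Asymptotics

variable {β : ℝ} {p : ℕ → ℝ}

/-- The coupling constant `β / (2 N p)` of an edge of the graph. -/
noncomputable def coupling (β p : ℝ) (N : ℕ) : ℝ := β / (2 * N * p)

theorem tendsto_mul_of_cube (hp₀ : ∀ N, 0 < p N) (hp₁ : ∀ N, p N ≤ 1)
    (hp : Tendsto (fun N : ℕ => p N ^ 3 * (N : ℝ) ^ 2) atTop atTop) :
    Tendsto (fun N : ℕ => (N : ℝ) * p N) atTop atTop := by
  refine tendsto_atTop_mono (fun N => ?_) (Real.tendsto_sqrt_atTop.comp hp)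
  have h := hp₀ N
  refine Real.sqrt_le_iff.2 ⟨by positivity, ?_⟩
  have h2 := mul_le_mul_of_nonneg_left (hp₁ N) (show 0 ≤ p N ^ 2 * (N : ℝ) ^ 2 by positivity)
  linarith

theorem tendsto_coupling (hp₀ : ∀ N, 0 < p N) (hp₁ : ∀ N, p N ≤ 1)
    (hp : Tendsto (fun N : ℕ => p N ^ 3 * (N : ℝ) ^ 2) atTop atTop) :
    Tendsto (fun N : ℕ => coupling β (p N) N) atTop (𝓝 0) := by
  have h := (tendsto_inv_atTop_zero.comp (tendsto_mul_of_cube hp₀ hp₁ hp)).const_mul (β / 2)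
  rw [mul_zero] at h
  refine h.congr fun N => ?_
  simp only [Function.comp, coupling]
  rw [mul_assoc 2, ← div_div, div_eq_mul_inv (β / 2)]

theorem eventually_abs_coupling_le (hp₀ : ∀ N, 0 < p N) (hp₁ : ∀ N, p N ≤ 1)
    (hp : Tendsto (fun N : ℕ => p N ^ 3 * (N : ℝ) ^ 2) atTop atTop) :
    ∀ᶠ N in atTop, |coupling β (p N) N| ≤ 1 / 8 := by
  have h := (tendsto_coupling (β := β) hp₀ hp₁ hp).abs
  rw [abs_zero] at h
  exact h.eventually_le_const (by norm_num)

theorem mul_coupling {N : ℕ} (hN : 0 < N) {p : ℝ} (hp₀ : 0 < p) : p * coupling β p N * N = β / 2 := by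
  have : (0:ℝ) < N := by exact_mod_cast hN
  rw [coupling]; field_simp

theorem tendsto_mul_of_abs_sub_le (hp₀ : ∀ N, 0 < p N) (hp₁ : ∀ N, p N ≤ 1)
    (hp : Tendsto (fun N : ℕ => p N ^ 3 * (N : ℝ) ^ 2) atTop atTop) {a : ℕ → ℝ} {C : ℝ}
    (ha : ∀ᶠ N in atTop, |a N - p N * coupling β (p N) N| ≤ C * (p N * coupling β (p N) N ^ 2)) :
    Tendsto (fun N : ℕ => a N * N) atTop (𝓝 (β / 2)) := by
  have hlim : Tendsto (fun N : ℕ => C * (β / 2 * coupling β (p N) N)) atTop (𝓝 0) := by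
    simpa using ((tendsto_coupling (β := β) hp₀ hp₁ hp).const_mul (β / 2)).const_mul C
  rw [tendsto_iff_norm_sub_tendsto_zero]
  refine squeeze_zero' (Eventually.of_forall fun _ => norm_nonneg _) ?_ hlim
  filter_upwards [ha, eventually_gt_atTop 0] with N h hN
  have hN' : (0:ℝ) < N := by exact_mod_cast hN
  rw [← mul_coupling hN (hp₀ N), ← sub_mul, norm_mul, Real.norm_eq_abs, Real.norm_of_nonneg hN'.le]
  calc _ ≤ C * (p N * coupling β (p N) N ^ 2) * N := mul_le_mul_of_nonneg_right h hN'.le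
    _ = _ := by ring

theorem tendsto_cgfOdd_coupling (hp₀ : ∀ N, 0 < p N) (hp₁ : ∀ N, p N ≤ 1)
    (hp : Tendsto (fun N : ℕ => p N ^ 3 * (N : ℝ) ^ 2) atTop atTop) :
    Tendsto (fun N : ℕ => cgfOdd (p N) (coupling β (p N) N) * N) atTop (𝓝 (β / 2)) := by
  refine tendsto_mul_of_abs_sub_le (C := 9) hp₀ hp₁ hp ?_
  filter_upwards [eventually_abs_coupling_le (β := β) hp₀ hp₁ hp] with N h
  rw [← mul_assoc]
  exact abs_cgfOdd_sub_le (hp₀ N) (hp₁ N) (by linarith)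

theorem tendsto_cgfOdd_two_coupling (hp₀ : ∀ N, 0 < p N) (hp₁ : ∀ N, p N ≤ 1)
    (hp : Tendsto (fun N : ℕ => p N ^ 3 * (N : ℝ) ^ 2) atTop atTop) :
    Tendsto (fun N : ℕ => cgfOdd (p N) (2 * coupling β (p N) N) / 2 * N) atTop (𝓝 (β / 2)) := by
  refine tendsto_mul_of_abs_sub_le (C := 18) hp₀ hp₁ hp ?_
  filter_upwards [eventually_abs_coupling_le (β := β) hp₀ hp₁ hp] with N h
  have := abs_le.1 (abs_cgfOdd_sub_le (hp₀ N) (hp₁ N) (x := 2 * coupling β (p N) N)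
    (by rw [abs_mul, abs_two]; linarith))
  rw [abs_le]
  constructor <;> linarith [this.1, this.2]

theorem abs_cgfEven_two_coupling_le {p x : ℝ} (hp₀ : 0 < p) (hp₁ : p ≤ 1) (hx : |x| ≤ 1 / 8) :
    |cgfEven p (2 * x) / 2 - p * (1 - p) * x ^ 2| ≤ 16 * p * x ^ 4 := by
  have := abs_le.1 (abs_cgfEven_sub_le hp₀ hp₁ (x := 2 * x) (by rw [abs_mul, abs_two]; linarith))
  rw [abs_le]
  constructor <;> linarith [this.1, this.2]

theorem tendsto_cgfEven_two_coupling (hp₀ : ∀ N, 0 < p N) (hp₁ : ∀ N, p N ≤ 1)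
    (hp : Tendsto (fun N : ℕ => p N ^ 3 * (N : ℝ) ^ 2) atTop atTop) :
    Tendsto (fun N : ℕ => cgfEven (p N) (2 * coupling β (p N) N) / 2 * N) atTop (𝓝 0) := by
  have hlim : Tendsto (fun N : ℕ => 17 * (β / 2 * coupling β (p N) N)) atTop (𝓝 0) := by
    simpa using ((tendsto_coupling (β := β) hp₀ hp₁ hp).const_mul (β / 2)).const_mul 17
  refine tendsto_of_tendsto_of_tendsto_of_le_of_le' tendsto_const_nhds hlim
    (Eventually.of_forall fun N => ?_) ?_
  · have := cgfEven_nonneg (hp₀ N) (hp₁ N) (2 * coupling β (p N) N)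
    positivity
  filter_upwards [eventually_abs_coupling_le (β := β) hp₀ hp₁ hp, eventually_gt_atTop 0] with N h hN
  have hN' : (0:ℝ) < N := by exact_mod_cast hN
  have h1 := (abs_le.1 (abs_cgfEven_two_coupling_le (hp₀ N) (hp₁ N) h)).2
  rw [← mul_coupling (β := β) hN (hp₀ N)]
  set x := coupling β (p N) N
  have hx2 : x ^ 2 ≤ 1 := by rw [← sq_abs]; exact pow_le_one₀ (abs_nonneg x) (by linarith)
  have hp := hp₀ N
  have h2 : p N * x ^ 4 ≤ p N * x ^ 2 := by
    refine mul_le_mul_of_nonneg_left ?_ hp.le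
    nlinarith [sq_nonneg x]
  have h3 : 0 ≤ p N ^ 2 * x ^ 2 := by positivity
  have h4 : cgfEven (p N) (2 * x) / 2 ≤ 17 * (p N * x ^ 2) := by linarith
  calc _ ≤ 17 * (p N * x ^ 2) * N := mul_le_mul_of_nonneg_right h4 hN'.le
    _ = _ := by ring

/-- Both terms have leading part p(1 - p)x², which cancels. The fourth-order errors 16px⁴ and 4px⁴
add up to the constant 20, and N²px⁴ = (β⁴/16)/(p³N²). -/
theorem tendsto_sq_mul_cgfEven_sub (hp₀ : ∀ N, 0 < p N) (hp₁ : ∀ N, p N ≤ 1)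
    (hp : Tendsto (fun N : ℕ => p N ^ 3 * (N : ℝ) ^ 2) atTop atTop) :
    Tendsto (fun N : ℕ => (N : ℝ) ^ 2 * (cgfEven (p N) (2 * coupling β (p N) N) / 2
      - 2 * cgfEven (p N) (coupling β (p N) N))) atTop (𝓝 0) := by
  have hlim : Tendsto (fun N : ℕ => 20 * (β ^ 4 / 16) * (p N ^ 3 * (N : ℝ) ^ 2)⁻¹) atTop (𝓝 0) := by
    simpa using (tendsto_inv_atTop_zero.comp hp).const_mul (20 * (β ^ 4 / 16))
  rw [tendsto_zero_iff_norm_tendsto_zero]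
  refine squeeze_zero' (Eventually.of_forall fun _ => norm_nonneg _) ?_ hlim
  filter_upwards [eventually_abs_coupling_le (β := β) hp₀ hp₁ hp, eventually_gt_atTop 0] with N h hN
  have hN' : (0:ℝ) < N := by exact_mod_cast hN
  have hp' := hp₀ N
  have h1 := abs_le.1 (abs_cgfEven_two_coupling_le (hp₀ N) (hp₁ N) h)
  have h2 := abs_le.1 (abs_cgfEven_sub_le (hp₀ N) (hp₁ N) (x := coupling β (p N) N) (by linarith))
  have h3 : |cgfEven (p N) (2 * coupling β (p N) N) / 2 - 2 * cgfEven (p N) (coupling β (p N) N)|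
      ≤ 20 * p N * coupling β (p N) N ^ 4 := by
    rw [abs_le]
    constructor <;> linarith [h1.1, h1.2, h2.1, h2.2]
  rw [norm_mul, Real.norm_of_nonneg (by positivity), Real.norm_eq_abs]
  calc _ ≤ (N : ℝ) ^ 2 * (20 * p N * coupling β (p N) N ^ 4) :=
        mul_le_mul_of_nonneg_left h3 (by positivity)
    _ = _ := by rw [coupling]; field_simp; norm_num

end Asymptotics

/-! ### Measurability and exponential moments of the random graph. -/

section RandomGraph

variable {Ω : Type*} [MeasurableSpace Ω] {P : Measure Ω} {N : ℕ} {p : ℝ} {G : Ω → Digraph (Fin N)}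

theorem finite_digraph (V : Type*) [Finite V] : Finite (Digraph V) :=
  Finite.of_injective (fun G : Digraph V => G.Adj) fun _ _ h => Digraph.ext h

/-- There are finitely many graphs on N vertices, and each fibre of G is a finite intersection of
edge events and their complements. -/
theorem IsDirectedErdosRenyi.measurable_comp (hG : IsDirectedErdosRenyi P N p G) {E : Type*}
    [MeasurableSpace E] (F : Digraph (Fin N) → E) : Measurable fun ω => F (G ω) := by
  let _ : MeasurableSpace (Digraph (Fin N)) := ⊤
  have := finite_digraph (Fin N)
  have hmeas : Measurable G := by
    refine measurable_to_countable' fun D => ?_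
    have : G ⁻¹' {D} = ⋂ i, ⋂ j, {ω | (G ω).Adj i j ↔ D.Adj i j} := by
      ext ω
      simp only [Set.mem_preimage, Set.mem_singleton_iff, Set.mem_iInter, Set.mem_ofPred_eq]
      exact ⟨fun h i j => by rw [h], fun h => Digraph.ext (by ext i j; exact h i j)⟩
    rw [this]
    refine MeasurableSet.iInter fun i => MeasurableSet.iInter fun j => ?_
    by_cases h : D.Adj i j
    · simpa [h] using hG.measurableSet_edge i j
    · have hc : {ω | (G ω).Adj i j ↔ D.Adj i j} = {ω | (G ω).Adj i j}ᶜ := by ext ω; simp [h]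
      rw [hc]
      exact (hG.measurableSet_edge i j).compl
  exact (measurable_from_top (f := F)).comp hmeas

theorem IsDirectedErdosRenyi.integrable_comp [IsFiniteMeasure P]
    (hG : IsDirectedErdosRenyi P N p G) (F : Digraph (Fin N) → ℝ) :
    Integrable (fun ω => F (G ω)) P := by
  have := finite_digraph (Fin N)
  obtain ⟨C, hC⟩ := (Set.finite_range fun D => ‖F D‖).bddAbove
  exact Integrable.of_bound (hG.measurable_comp F).aestronglyMeasurable C
    (ae_of_all _ fun ω => hC ⟨G ω, rfl⟩)

theorem IsDirectedErdosRenyi.integral_exp_edge [IsProbabilityMeasure P]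
    (hG : IsDirectedErdosRenyi P N p G) (hp₀ : 0 < p) (hp₁ : p ≤ 1) (i j : Fin N) (s : ℝ) :
    ∫ ω, Real.exp (s * edgeIndicator (G ω) i j) ∂P = Real.exp (bernoulliCgf p s) := by
  have h1 : ∀ ω, Real.exp (s * edgeIndicator (G ω) i j)
      = 1 + (Real.exp s - 1) * {ω | (G ω).Adj i j}.indicator (fun _ => (1 : ℝ)) ω := by
    intro ω
    by_cases h : (G ω).Adj i j <;> simp [edgeIndicator, h]
  simp_rw [h1]
  rw [integral_add (integrable_const _)
      (((integrable_const (1 : ℝ)).indicator (hG.measurableSet_edge i j)).const_mul _),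
    integral_const_mul, integral_indicator_const _ (hG.measurableSet_edge i j), Measure.real,
    hG.prob_edge, ENNReal.toReal_ofReal hp₀.le, bernoulliCgf, Real.exp_log (bernoulli_mgf_pos hp₀ hp₁ s)]
  simp
  ring

theorem IsDirectedErdosRenyi.integral_exp_sum [IsProbabilityMeasure P]
    (hG : IsDirectedErdosRenyi P N p G) (hp₀ : 0 < p) (hp₁ : p ≤ 1) (s : Fin N → Fin N → ℝ) :
    ∫ ω, Real.exp (∑ i, ∑ j, s i j * edgeIndicator (G ω) i j) ∂P
      = Real.exp (∑ i, ∑ j, bernoulliCgf p (s i j)) := by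
  have hind := hG.indep_edge.iIndepFun_indicator (β := ℝ) (m := Real.measurableSpace)
  have hX : ∀ (e : Fin N × Fin N) ω,
      {ω | (G ω).Adj e.1 e.2}.indicator (fun _ => (1 : ℝ)) ω = edgeIndicator (G ω) e.1 e.2 := by
    intro e ω
    by_cases h : (G ω).Adj e.1 e.2 <;> simp [edgeIndicator, h]
  have key := hind.integral_fun_prod_comp (f := fun e x => Real.exp (s e.1 e.2 * x))
    (fun e => (measurable_const.indicator (hG.measurableSet_edge e.1 e.2)).aemeasurable)
    (fun e => Continuous.aestronglyMeasurable (by fun_prop))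
  simp_rw [hX, hG.integral_exp_edge hp₀ hp₁, ← Real.exp_sum, Fintype.sum_prod_type] at key
  exact key

end RandomGraph

/-! ### Energies of one and two replicas after averaging over the graph. -/

theorem spin_eq_one_or {N : ℕ} (σ : Fin N → ℤˣ) (i : Fin N) : spin σ i = 1 ∨ spin σ i = -1 := by
  rcases Int.units_eq_one_or (σ i) with h | h <;> simp [spin, h]

theorem spin_mul {N : ℕ} (σ τ : Fin N → ℤˣ) (i : Fin N) : spin (σ * τ) i = spin σ i * spin τ i := by
  simp [spin]

theorem spin_mul_spin_eq_one_or {N : ℕ} (σ : Fin N → ℤˣ) (i j : Fin N) :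
    spin σ i * spin σ j = 1 ∨ spin σ i * spin σ j = -1 := by
  rcases spin_eq_one_or σ i with h | h <;> rcases spin_eq_one_or σ j with h' | h' <;> simp [h, h']

theorem sum_mul_spin_mul_spin {N : ℕ} (c : ℝ) (σ : Fin N → ℤˣ) :
    ∑ i, ∑ j, c * (spin σ i * spin σ j) = c * spinSum σ ^ 2 := by
  rw [spinSum, sq, Finset.sum_mul_sum]
  simp_rw [Finset.mul_sum]

theorem neg_mul_hamiltonian {N : ℕ} (β p : ℝ) (G : Digraph (Fin N)) (σ : Fin N → ℤˣ) :
    -β * hamiltonian p G σ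
      = ∑ i, ∑ j, coupling β p N * (spin σ i * spin σ j) * edgeIndicator G i j := by
  rw [hamiltonian, coupling, ← mul_assoc, Finset.mul_sum]
  refine Finset.sum_congr rfl fun i _ => ?_
  rw [Finset.mul_sum]
  refine Finset.sum_congr rfl fun j _ => ?_
  ring

theorem sum_bernoulliCgf {N : ℕ} (p x : ℝ) (σ : Fin N → ℤˣ) :
    ∑ i, ∑ j, bernoulliCgf p (x * (spin σ i * spin σ j))
      = (N : ℝ) ^ 2 * cgfEven p x + cgfOdd p x * spinSum σ ^ 2 := by
  have h : ∀ i j, bernoulliCgf p (x * (spin σ i * spin σ j))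
      = cgfEven p x + cgfOdd p x * (spin σ i * spin σ j) := by
    intro i j
    rcases spin_mul_spin_eq_one_or σ i j with h | h <;> rw [h, cgfEven, cgfOdd] <;> ring_nf
  simp_rw [h, Finset.sum_add_distrib, sum_mul_spin_mul_spin]
  simp
  ring

/-- For signs s, t the sum x(s + t) is 0 or ±2x, so the function is half the even part times 1 + st
plus half the odd part times s + t. The product st is the edge sign of σ * τ, whose total spin is
the overlap. -/
theorem sum_bernoulliCgf_pair {N : ℕ} (p x : ℝ) (σ τ : Fin N → ℤˣ) :
    ∑ i, ∑ j, bernoulliCgf p (x * (spin σ i * spin σ j) + x * (spin τ i * spin τ j))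
      = (N : ℝ) ^ 2 * (cgfEven p (2 * x) / 2) + (cgfOdd p (2 * x) / 2 * spinSum σ ^ 2
        + cgfOdd p (2 * x) / 2 * spinSum τ ^ 2 + cgfEven p (2 * x) / 2 * spinSum (σ * τ) ^ 2) := by
  have h0 : bernoulliCgf p 0 = 0 := by simp [bernoulliCgf]
  have h : ∀ i j, bernoulliCgf p (x * (spin σ i * spin σ j) + x * (spin τ i * spin τ j))
      = cgfEven p (2 * x) / 2 + (cgfOdd p (2 * x) / 2 * (spin σ i * spin σ j)
        + cgfOdd p (2 * x) / 2 * (spin τ i * spin τ j)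
        + cgfEven p (2 * x) / 2 * (spin (σ * τ) i * spin (σ * τ) j)) := by
    intro i j
    have h3 : spin (σ * τ) i * spin (σ * τ) j = (spin σ i * spin σ j) * (spin τ i * spin τ j) := by
      rw [spin_mul, spin_mul]; ring
    rw [h3]
    rcases spin_mul_spin_eq_one_or σ i j with h | h <;>
      rcases spin_mul_spin_eq_one_or τ i j with h' | h' <;> rw [h, h', cgfEven, cgfOdd]
    · rw [show x * 1 + x * 1 = 2 * x by ring]; ring
    · rw [show x * 1 + x * -1 = 0 by ring, h0]; ring
    · rw [show x * -1 + x * 1 = 0 by ring, h0]; ring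
    · rw [show x * -1 + x * -1 = -(2 * x) by ring]; ring
  simp_rw [h, Finset.sum_add_distrib, sum_mul_spin_mul_spin]
  simp
  ring

/-! ### First and second moments over the graph. -/

/-- The unnormalized Gibbs average of `g`, divided by its annealed order of magnitude. -/
noncomputable def gibbsSum {N : ℕ} (β p : ℝ) (g : (Fin N → ℤˣ) → ℝ) (G : Digraph (Fin N)) : ℝ :=
  Real.exp (-((N : ℝ) ^ 2 * cgfEven p (coupling β p N)))
    * spinMean fun σ => Real.exp (-β * hamiltonian p G σ) * g σ

section Moments

variable {Ω : Type*} [MeasurableSpace Ω] {P : Measure Ω} {N : ℕ} {p : ℝ}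
  {G : Ω → Digraph (Fin N)}

theorem integral_spinMean {F : (Fin N → ℤˣ) → Ω → ℝ} (hF : ∀ σ, Integrable (F σ) P) :
    ∫ ω, spinMean (fun σ => F σ ω) ∂P = spinMean fun σ => ∫ ω, F σ ω ∂P := by
  simp only [spinMean]
  rw [integral_div, integral_finsetSum _ fun σ _ => hF σ]

theorem IsDirectedErdosRenyi.integral_gibbsSum [IsProbabilityMeasure P] (hG : IsDirectedErdosRenyi P N p G) (hp₀ : 0 < p)
    (hp₁ : p ≤ 1) (β : ℝ) (g : (Fin N → ℤˣ) → ℝ) :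
    ∫ ω, gibbsSum β p g (G ω) ∂P
      = spinMean fun σ => Real.exp (cgfOdd p (coupling β p N) * spinSum σ ^ 2) * g σ := by
  simp only [gibbsSum]
  rw [integral_const_mul, integral_spinMean fun σ =>
    hG.integrable_comp fun D => Real.exp (-β * hamiltonian p D σ) * g σ, ← spinMean_const_mul]
  congr 1
  ext σ
  simp_rw [integral_mul_const, neg_mul_hamiltonian]
  rw [hG.integral_exp_sum hp₀ hp₁, sum_bernoulliCgf, ← mul_assoc, ← Real.exp_add, neg_add_cancel_left]

theorem IsDirectedErdosRenyi.integral_gibbsSum_sq [IsProbabilityMeasure P] (hG : IsDirectedErdosRenyi P N p G) (hp₀ : 0 < p)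
    (hp₁ : p ≤ 1) (β : ℝ) (g : (Fin N → ℤˣ) → ℝ) :
    ∫ ω, gibbsSum β p g (G ω) ^ 2 ∂P
      = Real.exp ((N : ℝ) ^ 2 * (cgfEven p (2 * coupling β p N) / 2
          - 2 * cgfEven p (coupling β p N)))
        * pairMean fun σ τ => Real.exp (cgfOdd p (2 * coupling β p N) / 2 * spinSum σ ^ 2)
          * Real.exp (cgfOdd p (2 * coupling β p N) / 2 * spinSum τ ^ 2)
          * Real.exp (cgfEven p (2 * coupling β p N) / 2 * spinSum (σ * τ) ^ 2) * (g σ * g τ) := by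
  have h1 : ∀ ω, gibbsSum β p g (G ω) ^ 2
      = Real.exp (-((N : ℝ) ^ 2 * (2 * cgfEven p (coupling β p N))))
        * pairMean fun σ τ => Real.exp (∑ i, ∑ j, (coupling β p N * (spin σ i * spin σ j)
          + coupling β p N * (spin τ i * spin τ j)) * edgeIndicator (G ω) i j) * (g σ * g τ) := by
    intro ω
    rw [gibbsSum, mul_pow, ← Real.exp_nat_mul, sq (spinMean _), ← pairMean_mul]
    congr 1
    · congr 1; push_cast; ring
    · congr 1
      ext σ τ
      simp_rw [neg_mul_hamiltonian, add_mul, Finset.sum_add_distrib, Real.exp_add]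
      ring
  have hint : ∀ σ τ, Integrable (fun ω => Real.exp (∑ i, ∑ j,
      (coupling β p N * (spin σ i * spin σ j) + coupling β p N * (spin τ i * spin τ j))
        * edgeIndicator (G ω) i j) * (g σ * g τ)) P := fun σ τ =>
    hG.integrable_comp fun D => Real.exp (∑ i, ∑ j,
      (coupling β p N * (spin σ i * spin σ j) + coupling β p N * (spin τ i * spin τ j))
        * edgeIndicator D i j) * (g σ * g τ)
  simp_rw [h1]
  simp only [pairMean]
  rw [integral_const_mul, integral_spinMean fun σ => ?_]
  · simp_rw [integral_spinMean fun τ => hint _ τ, integral_mul_const,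
      hG.integral_exp_sum hp₀ hp₁, sum_bernoulliCgf_pair]
    rw [← spinMean_const_mul, ← spinMean_const_mul]
    congr 1
    ext σ
    rw [← spinMean_const_mul, ← spinMean_const_mul]
    congr 1
    ext τ
    simp only [← mul_assoc, ← Real.exp_add]
    congr 3
    ring
  · exact (integrable_finsetSum _ fun τ _ => hint σ τ).div_const _

end Moments

/-! ### Concentration of Gibbs sums and of the distribution function. -/

section Concentration

variable {β : ℝ} {p : ℕ → ℝ} {Ω : ℕ → Type*} [∀ N, MeasurableSpace (Ω N)] {P : ∀ N, Measure (Ω N)}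
  [∀ N, IsProbabilityMeasure (P N)] {G : ∀ N, Ω N → Digraph (Fin N)}

/-- Without the overlap factor the pair average is the square of a one-replica average. Since |g| ≤
1, the correction is at most `overlapExcess`. -/
theorem tendsto_integral_gibbsSum_sq (hβ₀ : 0 < β) (hβ₁ : β < 1) (hp₀ : ∀ N, 0 < p N)
    (hp₁ : ∀ N, p N ≤ 1) (hp : Tendsto (fun N : ℕ => p N ^ 3 * (N : ℝ) ^ 2) atTop atTop)
    (hG : ∀ N, IsDirectedErdosRenyi (P N) N (p N) (G N)) {g : ∀ N : ℕ, (Fin N → ℤˣ) → ℝ} {m : ℝ}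
    (hg1 : ∀ N σ, |g N σ| ≤ 1)
    (hg : ∀ a : ℕ → ℝ, Tendsto (fun N : ℕ => a N * N) atTop (𝓝 (β / 2)) →
      Tendsto (fun N : ℕ => spinMean fun σ => Real.exp (a N * spinSum σ ^ 2) * g N σ) atTop (𝓝 m)) :
    Tendsto (fun N => ∫ ω, gibbsSum β (p N) (g N) (G N ω) ^ 2 ∂(P N)) atTop (𝓝 (m ^ 2)) := by
  have hodd := tendsto_cgfOdd_two_coupling (β := β) hp₀ hp₁ hp
  have hex := tendsto_overlapExcess hβ₀ hβ₁ hodd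
    (tendsto_cgfEven_two_coupling (β := β) hp₀ hp₁ hp)
    (Eventually.of_forall fun N => div_nonneg (cgfEven_nonneg (hp₀ N) (hp₁ N) _) zero_le_two)
  have hpre := (Real.continuous_exp.tendsto _).comp
    (tendsto_sq_mul_cgfEven_sub (β := β) hp₀ hp₁ hp)
  rw [Real.exp_zero] at hpre
  set a : ℕ → ℝ := fun N => cgfOdd (p N) (2 * coupling β (p N) N) / 2
  set b : ℕ → ℝ := fun N => cgfEven (p N) (2 * coupling β (p N) N) / 2
  have hb0 : ∀ N, 0 ≤ b N := fun N => div_nonneg (cgfEven_nonneg (hp₀ N) (hp₁ N) _) zero_le_two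
  have herr : Tendsto (fun N : ℕ => pairMean fun σ τ : Fin N → ℤˣ =>
      Real.exp (a N * spinSum σ ^ 2) * Real.exp (a N * spinSum τ ^ 2)
        * (Real.exp (b N * spinSum (σ * τ) ^ 2) - 1) * (g N σ * g N τ)) atTop (𝓝 0) := by
    refine squeeze_zero_norm (fun N => ?_) hex
    refine (abs_pairMean_le _).trans (pairMean_mono fun σ τ => ?_)
    have h1 : 0 ≤ Real.exp (b N * spinSum (σ * τ) ^ 2) - 1 := by
      have := hb0 N
      linarith [Real.one_le_exp (show 0 ≤ b N * spinSum (σ * τ) ^ 2 by positivity)]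
    have h2 : |g N σ * g N τ| ≤ 1 := by
      rw [abs_mul]; exact mul_le_one₀ (hg1 N σ) (abs_nonneg _) (hg1 N τ)
    have h3 : 0 ≤ Real.exp (a N * spinSum σ ^ 2) * Real.exp (a N * spinSum τ ^ 2)
        * (Real.exp (b N * spinSum (σ * τ) ^ 2) - 1) := by positivity
    rw [abs_mul, abs_of_nonneg h3]
    exact mul_le_of_le_one_right h3 h2
  have hmain := hpre.mul (((hg a hodd).pow 2).add herr)
  rw [one_mul, add_zero] at hmain
  refine hmain.congr fun N => ?_
  rw [(hG N).integral_gibbsSum_sq (hp₀ N) (hp₁ N)]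
  simp only [Function.comp]
  congr 1
  rw [sq, ← pairMean_mul, ← pairMean_add]
  congr 1
  ext σ τ
  ring

theorem tendsto_measure_gibbsSum (hβ₀ : 0 < β) (hβ₁ : β < 1) (hp₀ : ∀ N, 0 < p N)
    (hp₁ : ∀ N, p N ≤ 1) (hp : Tendsto (fun N : ℕ => p N ^ 3 * (N : ℝ) ^ 2) atTop atTop)
    (hG : ∀ N, IsDirectedErdosRenyi (P N) N (p N) (G N)) {g : ∀ N : ℕ, (Fin N → ℤˣ) → ℝ} {m : ℝ}
    (hg1 : ∀ N σ, |g N σ| ≤ 1)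
    (hg : ∀ a : ℕ → ℝ, Tendsto (fun N : ℕ => a N * N) atTop (𝓝 (β / 2)) →
      Tendsto (fun N : ℕ => spinMean fun σ => Real.exp (a N * spinSum σ ^ 2) * g N σ) atTop (𝓝 m))
    {δ : ℝ} (hδ : 0 < δ) :
    Tendsto (fun N => P N {ω | δ ≤ |gibbsSum β (p N) (g N) (G N ω) - m|}) atTop (𝓝 0) := by
  have h2 := tendsto_integral_gibbsSum_sq hβ₀ hβ₁ hp₀ hp₁ hp hG hg1 hg
  have h1 := hg _ (tendsto_cgfOdd_coupling hp₀ hp₁ hp)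
  have hvar : Tendsto (fun N => ENNReal.ofReal
      ((∫ ω, (gibbsSum β (p N) (g N) (G N ω) - m) ^ 2 ∂(P N)) / δ ^ 2)) atTop (𝓝 0) := by
    have h3 := ((h2.sub (h1.const_mul (2 * m))).add_const (m ^ 2)).div_const (δ ^ 2)
    rw [show (m ^ 2 - 2 * m * m + m ^ 2) / δ ^ 2 = 0 by ring] at h3
    have h4 := (ENNReal.continuous_ofReal.tendsto _).comp h3
    rw [ENNReal.ofReal_zero] at h4
    refine h4.congr fun N => ?_
    simp only [Function.comp]
    congr 2
    rw [← (hG N).integral_gibbsSum (hp₀ N) (hp₁ N)]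
    have i1 := (hG N).integrable_comp fun D => gibbsSum β (p N) (g N) D
    have i2 := (hG N).integrable_comp fun D => gibbsSum β (p N) (g N) D ^ 2
    have i3 : Integrable (fun ω => gibbsSum β (p N) (g N) (G N ω) ^ 2
        - 2 * gibbsSum β (p N) (g N) (G N ω) * m) (P N) := i2.sub ((i1.const_mul 2).mul_const m)
    simp_rw [sub_sq]
    rw [integral_add i3 (integrable_const _),
      integral_sub i2 ((i1.const_mul 2).mul_const m), integral_mul_const, integral_const_mul]
    simp
    ring
  refine tendsto_of_tendsto_of_tendsto_of_le_of_le tendsto_const_nhds hvar (fun _ => zero_le) fun N => ?_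
  have hm := mul_meas_ge_le_integral_of_nonneg (μ := P N) (ae_of_all _ fun ω => sq_nonneg _)
    ((hG N).integrable_comp fun D => (gibbsSum β (p N) (g N) D - m) ^ 2) (δ ^ 2)
  have hset : {ω | δ ≤ |gibbsSum β (p N) (g N) (G N ω) - m|}
      = {ω | δ ^ 2 ≤ (gibbsSum β (p N) (g N) (G N ω) - m) ^ 2} := by
    ext ω
    simp only [Set.mem_ofPred_eq]
    rw [sq_le_sq, abs_of_pos hδ]
  simp only
  rw [hset, ← ofReal_measureReal]
  refine ENNReal.ofReal_le_ofReal ?_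
  rw [le_div_iff₀ (by positivity), mul_comm]
  exact hm

/-- Moving `c` inside the numerator makes its limit 0, so the denominator need only be bounded
below. -/
theorem magnetizationLaw_real_Iic_sub {N : ℕ} (β p : ℝ) (G : Digraph (Fin N)) (t c : ℝ) :
    (magnetizationLaw β p G : Measure ℝ).real (Set.Iic t) - c
      = gibbsSum β p (fun σ => (Set.Iic t).indicator 1 (scaledMag σ) - c) G
        / gibbsSum β p (fun _ => 1) G := by
  have hZ : 0 < ∑ σ : Fin N → ℤˣ, Real.exp (-β * hamiltonian p G σ) := partitionFunction_pos β p G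
  have h := weightedMeasure_real_Iic (W := fun σ => Real.exp (-β * hamiltonian p G σ))
    (fun _ => Real.exp_pos _) t
  rw [← magnetizationMeasure_eq] at h
  refine (congrArg (· - c) h).trans ?_
  have hE := Real.exp_pos (-((N : ℝ) ^ 2 * cgfEven p (coupling β p N)))
  simp only [gibbsSum, spinMean, mul_one, mul_sub, Finset.sum_sub_distrib, ← Finset.sum_mul]
  field_simp

theorem tendsto_measure_cdf (hβ₀ : 0 < β) (hβ₁ : β < 1) (hp₀ : ∀ N, 0 < p N)
    (hp₁ : ∀ N, p N ≤ 1) (hp : Tendsto (fun N : ℕ => p N ^ 3 * (N : ℝ) ^ 2) atTop atTop)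
    (hG : ∀ N, IsDirectedErdosRenyi (P N) N (p N) (G N)) (t : ℝ) {δ : ℝ} (hδ : 0 < δ) :
    Tendsto (fun N => P N {ω | δ ≤ |(magnetizationLaw β (p N) (G N ω) : Measure ℝ).real (Set.Iic t)
      - (normalLaw (1 / (1 - β)) : Measure ℝ).real (Set.Iic t)|}) atTop (𝓝 0) := by
  set c := (normalLaw (1 / (1 - β)) : Measure ℝ).real (Set.Iic t) with hc
  have hc0 : 0 ≤ c := measureReal_nonneg
  have hc1 : c ≤ 1 := measureReal_le_one
  have hden := tendsto_measure_gibbsSum hβ₀ hβ₁ hp₀ hp₁ hp hG (g := fun _ _ => 1)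
    (m := (√(1 - β))⁻¹) (by simp)
    (fun a ha => by simpa using tendsto_spinMean_exp_sq hβ₀ hβ₁ ha) (δ := 1 / 2) (by norm_num)
  have hnum := tendsto_measure_gibbsSum hβ₀ hβ₁ hp₀ hp₁ hp hG
    (g := fun _ σ => (Set.Iic t).indicator 1 (scaledMag σ) - c) (m := 0)
    (fun N σ => by
      by_cases h : scaledMag σ ∈ Set.Iic t
      · rw [Set.indicator_of_mem h, Pi.one_apply, abs_le]; constructor <;> linarith
      · rw [Set.indicator_of_notMem h, abs_le]; constructor <;> linarith)
    (fun a ha => by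
      have h := (tendsto_spinMean_exp_sq_mul_indicator hβ₀ hβ₁ ha t).sub
        ((tendsto_spinMean_exp_sq hβ₀ hβ₁ ha).mul_const c)
      rw [sub_self] at h
      refine h.congr fun N => ?_
      simp_rw [mul_sub, sub_eq_add_neg, spinMean_add, ← mul_neg, spinMean_mul_const])
    (δ := δ / 2) (by positivity)
  have hsum := hnum.add hden
  rw [add_zero] at hsum
  refine tendsto_of_tendsto_of_tendsto_of_le_of_le tendsto_const_nhds hsum (fun _ => zero_le) fun N => ?_
  refine (measure_mono fun ω hω => ?_).trans (measure_union_le _ _)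
  by_contra hcon
  simp only [Set.mem_union, Set.mem_ofPred_eq, not_or, not_le, sub_zero] at hcon hω
  obtain ⟨h1, h2⟩ := hcon
  -- The denominator's limit is at least 1, so a deviation below 1/2 leaves it above 1/2; a
  -- numerator below δ/2 then forces a quotient below δ.
  have hm : 1 ≤ (√(1 - β))⁻¹ := by
    rw [one_le_inv₀ (Real.sqrt_pos.2 (by linarith))]
    exact Real.sqrt_le_one.2 (by linarith)
  have h3 : 1 / 2 < gibbsSum β (p N) (fun _ => 1) (G N ω) := by linarith [(abs_lt.1 h2).1]
  rw [magnetizationLaw_real_Iic_sub, abs_div, abs_of_pos (by linarith : 0 < gibbsSum β (p N)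
    (fun _ => 1) (G N ω)), le_div_iff₀ (by linarith)] at hω
  nlinarith

end Concentration

/-! ### From pointwise distribution functions to the Lévy metric. -/

/-- Closeness of the distribution functions at finitely many points bounds the Lévy distance. -/
theorem exists_finset_levyDist_le (ν : ProbabilityMeasure ℝ) {ε : ℝ} (hε : 0 < ε) :
    ∃ F : Finset ℝ, ∀ μ : ProbabilityMeasure ℝ,
      (∀ t ∈ F, |(μ : Measure ℝ).real (Set.Iic t) - (ν : Measure ℝ).real (Set.Iic t)| < ε / 2) →
        levyDist μ ν ≤ ε := by
  have hmono : ∀ (μ : ProbabilityMeasure ℝ) {s t : ℝ}, s ≤ t →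
      (μ : Measure ℝ).real (Set.Iic s) ≤ (μ : Measure ℝ).real (Set.Iic t) :=
    fun μ s t h => measureReal_mono (Set.Iic_subset_Iic.2 h)
  obtain ⟨A, hA⟩ := ((tendsto_cdf_atBot (ν : Measure ℝ)).eventually_lt_const
    (show 0 < ε / 2 by positivity)).exists
  obtain ⟨B, hB⟩ := ((tendsto_cdf_atTop (ν : Measure ℝ)).eventually_const_lt
    (show 1 - ε / 2 < 1 by linarith)).exists
  rw [cdf_eq_real] at hA hB
  obtain ⟨n, hn⟩ := exists_nat_ge ((B - A) / ε)
  rw [div_le_iff₀ hε] at hn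
  -- A grid of mesh ε from A to beyond B, outside of which ν has tails below ε/2. Index n already
  -- reaches B; n + 1 closes the cell starting at index n.
  refine ⟨(Finset.range (n + 2)).image fun k : ℕ => A + k * ε, fun μ hμ => ?_⟩
  have hF : ∀ k : ℕ, k ≤ n + 1 →
      |(μ : Measure ℝ).real (Set.Iic (A + k * ε)) - (ν : Measure ℝ).real (Set.Iic (A + k * ε))|
        < ε / 2 := fun k hk =>
    hμ _ (Finset.mem_image.2 ⟨k, Finset.mem_range.2 (by omega), rfl⟩)
  refine csInf_le ⟨0, fun x hx => hx.1.le⟩ ⟨hε, fun t => ?_⟩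
  rcases lt_or_ge t A with ht | ht
  · have h0 := hF 0 (by omega)
    simp only [Nat.cast_zero, zero_mul, add_zero] at h0
    have h1 := hmono μ (show t - ε ≤ A by linarith)
    have h2 := hmono ν ht.le
    have h3 : 0 ≤ (ν : Measure ℝ).real (Set.Iic t) := measureReal_nonneg
    have h4 : 0 ≤ (μ : Measure ℝ).real (Set.Iic (t + ε)) := measureReal_nonneg
    have h5 := (abs_lt.1 h0).2
    constructor <;> linarith
  · set k := ⌊(t - A) / ε⌋₊ with hk
    have hk1 : A + k * ε ≤ t := by
      have := Nat.floor_le (show 0 ≤ (t - A) / ε from div_nonneg (by linarith) hε.le)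
      rw [le_div_iff₀ hε] at this
      linarith
    have hk2 : t < A + k * ε + ε := by
      have := Nat.lt_floor_add_one ((t - A) / ε)
      rw [div_lt_iff₀ hε] at this
      linarith
    rcases le_or_gt k n with hkn | hkn
    · have h1 := (abs_lt.1 (hF k (by omega))).2
      have h2 := (abs_lt.1 (hF (k + 1) (by omega))).1
      push_cast at h2
      have h3 := hmono μ (show t - ε ≤ A + k * ε by linarith)
      have h4 := hmono ν hk1
      have h5 := hmono ν (show t ≤ A + (k + 1) * ε by linarith)
      have h6 := hmono μ (show A + (k + 1) * ε ≤ t + ε by linarith)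
      constructor <;> linarith
    · have h0 : A + n * ε ≤ t := by
        have : (n : ℝ) * ε ≤ k * ε := mul_le_mul_of_nonneg_right (by exact_mod_cast hkn.le) hε.le
        linarith
      have h1 := (abs_lt.1 (hF n (by omega))).1
      have h2 := hmono ν (show B ≤ A + n * ε by linarith)
      have h3 := hmono ν h0
      have h4 := hmono μ (show A + n * ε ≤ t + ε by linarith)
      have h5 : (μ : Measure ℝ).real (Set.Iic (t - ε)) ≤ 1 := measureReal_le_one
      have h6 : (ν : Measure ℝ).real (Set.Iic t) ≤ 1 := measureReal_le_one
      constructor <;> linarith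

end DiluteIsing

/-- Quenched central limit theorem for the magnetization of the high-temperature Ising model on
the directed Erdős–Rényi graph. -/
theorem theorem1p1 (β : ℝ) (hβ₀ : 0 < β) (hβ₁ : β < 1)
    (p : ℕ → ℝ) (hp₀ : ∀ N, 0 < p N) (hp₁ : ∀ N, p N ≤ 1)
    (hp : Tendsto (fun N : ℕ => p N ^ 3 * (N : ℝ) ^ 2) atTop atTop)
    (Ω : ℕ → Type*) [∀ N, MeasurableSpace (Ω N)]
    (P : ∀ N, Measure (Ω N)) [∀ N, IsProbabilityMeasure (P N)]
    (G : ∀ N, Ω N → Digraph (Fin N))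
    (hG : ∀ N, DiluteIsing.IsDirectedErdosRenyi (P N) N (p N) (G N)) :
    (∀ N, Measurable fun ω => DiluteIsing.magnetizationLaw β (p N) (G N ω)) ∧
    ∀ ε : ℝ, 0 < ε →
      Tendsto (fun N => P N {ω | ε <
          DiluteIsing.levyDist (DiluteIsing.magnetizationLaw β (p N) (G N ω))
            (DiluteIsing.normalLaw (1 / (1 - β)))})
        atTop (𝓝 0) := by
  refine ⟨fun N => (hG N).measurable_comp _, fun ε hε => ?_⟩
  obtain ⟨F, hF⟩ := DiluteIsing.exists_finset_levyDist_le (DiluteIsing.normalLaw (1 / (1 - β))) hε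
  -- The finite set depends only on the limit law and ε, not on N, so a union bound suffices.
  have hsum := tendsto_finsetSum F fun t _ =>
    DiluteIsing.tendsto_measure_cdf hβ₀ hβ₁ hp₀ hp₁ hp hG t (half_pos hε)
  rw [Finset.sum_const_zero] at hsum
  refine tendsto_of_tendsto_of_tendsto_of_le_of_le tendsto_const_nhds hsum (fun _ => zero_le) fun N => ?_
  refine (measure_mono fun ω hω => ?_).trans (measure_biUnion_finset_le _ _)
  by_contra hcon
  simp only [Set.mem_iUnion, Set.mem_ofPred_eq, not_exists, not_le] at hcon
  exact absurd (hF _ hcon) (not_le.2 hω)
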